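/- An \emph{$r$-graph} is a finite hypergraph all of whose edges have exactly $r$ vertices (no repeated edges); $e(H)$ is the number of edges of $H$, its maximum degree is the largest number of edges containing a vertex, and $K_n^r$ is the complete $r$-graph on $n$ vertices. For $k\ge 2$, an $r$-graph $F$ is an \emph{($r$-uniform) Berge $k$-cycle} if it has exactly $k$ edges and there are distinct vertices $v_1,\dots,v_k$ and an enumeration $e_1,\dots,e_k$ of its edges such that $v_i,v_{i+1}\in e_i$ for all $i$ (with $v_{k+1}=v_1$). Let $\mathcal{B}_{[\ell]}^r$ be the family of all $r$-uniform Berge $k$-cycles with $2\le k\le \ell$. A hypergraph $S$ is a \emph{sunflower} if there is a set $K$ such that $e\cap e'=K$ for all distinct edges $e,e'$ of $S$; let $\mathcal{B}_{[\ell]}^{r,*}$ consist of the members of $\mathcal{B}_{[\ell]}^r$ that are not sunflowers. For a family $\mathcal{F}$ of $r$-graphs, $\mathrm{ex}(H,\mathcal{F})$ is the maximum number of edges of a subgraph of $H$ containing no member of $\mathcal{F}$ as a subgraph, and $\mathrm{ex}(n,\mathcal{F})=\mathrm{ex}(K_n^r,\mathcal{F})$. \textbf{Theorem.} Let $\ell,r\ge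 3$ be integers such that, as $n\to\infty$, \[\mathrm{ex}(n,\mathcal{B}_{[\ell]}^r)\ge n^{1+\frac{1}{\lfloor \ell/2\rfloor}-o(1)}.\tag{$*$}\] Then every $r$-graph $H$ with maximum degree at most $\Delta$ satisfies \[\mathrm{ex}(H,\mathcal{B}_{[\ell]}^{r,*})\ge \Delta^{-1+\frac{1}{(r-1)\lfloor \ell/2\rfloor}-o(1)}\cdot e(H),\] where $o(1)$ tends to $0$ as $\Delta\to\infty$ and depends only on $\Delta$, $\ell$ and $r$ (not on $H$). Moreover, this bound is tight up to the $o(1)$ term in the exponent: with $n=\lfloor\Delta^{1/(r-1)}\rfloor$, the clique $K_n^r$ has maximum degree at most $\Delta$, for $\Delta$ sufficiently large it has at least one edge, and \[\mathrm{ex}(K_n^r,\mathcal{B}_{[\ell]}^{r,*})\le \Delta^{-1+\frac{1}{(r-1)\lfloor \ell/2\rfloor}+o(1)}\cdot e(K_n^r)\qquad(\Delta\to\infty).\] -/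

import Mathlib

/-! Finite hypergraphs are given by their edge sets: a hypergraph whose vertex set is the type `V`
is a `Finset (Finset V)`, and its (spanning) subgraphs are the subsets of this edge set. -/

namespace Hypergraph

/-- `H` is an `r`-graph: every edge has exactly `r` vertices. -/
def IsUniform {V : Type*} (r : ℕ) (H : Finset (Finset V)) : Prop :=
  ∀ e ∈ H, e.card = r

/-- The complete `r`-graph with vertex set `V`. -/
def complete (V : Type*) [Fintype V] (r : ℕ) : Finset (Finset V) :=
  Finset.powersetCard r Finset.univ

/-- The degree of a vertex: the number of edges containing it. -/
def degree {V : Type*} [DecidableEq V] (H : Finset (Finset V)) (v : V) : ℕ :=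
  (H.filter (fun e => v ∈ e)).card

/-- The maximum degree over all vertices. -/
def maxDegree {V : Type*} [Fintype V] [DecidableEq V] (H : Finset (Finset V)) : ℕ :=
  Finset.univ.sup (degree H)

/-- `H` contains no member of the (isomorphism-closed) family `𝓕` as a subgraph. -/
def IsFree {V : Type*} (𝓕 : Finset (Finset V) → Prop) (H : Finset (Finset V)) : Prop :=
  ∀ F ⊆ H, ¬ 𝓕 F

open Classical in
/-- The relative Turán number `ex(H, 𝓕)`: the maximum number of edges of an `𝓕`-free
subgraph of `H`. -/
noncomputable def relEx {V : Type*} (H : Finset (Finset V)) (𝓕 : Finset (Finset V) → Prop) : ℕ :=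
  (H.powerset.filter (fun G => IsFree 𝓕 G)).sup Finset.card

/-- Let `E : ι → Finset W` be a hypergraph with vertex set `W` and edges indexed by `ι`
(parallel edges are allowed). `F` is a Berge-`E` if, after identifying `W` with a set of vertices
of `F`, there is a bijection `φ` from the edges of `E` to those of `F` with `E i ⊆ φ i`. -/
def IsBerge {W ι V : Type*} (E : ι → Finset W) (F : Finset (Finset V)) : Prop :=
  ∃ f : W ↪ V, ∃ φ : ι ≃ {e // e ∈ F}, ∀ i, (E i).map f ⊆ (φ i : Finset V)

/-- The `ℓ`-cycle: vertices `0, …, ℓ - 1`, and the `i`-th edge joins `i` to its cyclic successor.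
For `ℓ = 2` this is a double edge. -/
def cycleEdges (ℓ : ℕ) : Fin ℓ → Finset (Fin ℓ) :=
  fun i => {i, finRotate ℓ i}

/-- `F` is an `r`-uniform Berge `ℓ`-cycle. -/
def IsBergeCycle {V : Type*} (r ℓ : ℕ) (F : Finset (Finset V)) : Prop :=
  IsUniform r F ∧ IsBerge (cycleEdges ℓ) F

/-- `F` is an `r`-uniform Berge cycle of length between `2` and `ℓ`. -/
def IsShortBergeCycle {V : Type*} (r ℓ : ℕ) (F : Finset (Finset V)) : Prop :=
  ∃ k, 2 ≤ k ∧ k ≤ ℓ ∧ IsBergeCycle r k F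

/-- `S` is a sunflower: all pairs of distinct edges have the same intersection. -/
def IsSunflower {V : Type*} [DecidableEq V] (S : Finset (Finset V)) : Prop :=
  ∃ K : Finset V, ∀ e ∈ S, ∀ e' ∈ S, e ≠ e' → e ∩ e' = K

/-- `F` is an `r`-uniform Berge cycle of length between `2` and `ℓ` that is not a sunflower. -/
def IsShortNonSunflowerBergeCycle {V : Type*} [DecidableEq V] (r ℓ : ℕ)
    (F : Finset (Finset V)) : Prop :=
  IsShortBergeCycle r ℓ F ∧ ¬ IsSunflower F

/-- The Turán number `ex(n, 𝓕)` of a family of `r`-graphs: the maximum number of edges of an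
`𝓕`-free `r`-graph with `n` vertices, i.e. of an `𝓕`-free subgraph of the complete one. -/
noncomputable def turanEx (r n : ℕ) (𝓕 : Finset (Finset (Fin n)) → Prop) : ℕ :=
  relEx (complete (Fin n) r) 𝓕

/-- The girth conjecture for the pair `(ℓ, r)`: the maximum number of edges of an `n`-vertex
`r`-graph without Berge cycles of length `2, …, ℓ` is at least `n ^ (1 + 1 / ⌊ℓ / 2⌋ - o(1))`
as `n → ∞`. -/
def GirthConjecture (ℓ r : ℕ) : Prop :=
  ∀ ε : ℝ, 0 < ε → ∃ n₀ : ℕ, ∀ n : ℕ, n₀ ≤ n →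
    (n : ℝ) ^ (1 + 1 / ((ℓ / 2 : ℕ) : ℝ) - ε) ≤ (turanEx r n (IsShortBergeCycle r ℓ) : ℝ)

end Hypergraph

namespace Hypergraph

/-! Lower bound. Write k = ⌊ℓ/2⌋. By induction on the uniformity s, 2 ≤ s ≤ r, an s-graph H of
maximum degree Δ has a good subgraph with about Δ^(-1 + 1/((s-1)k)) of its edges. Put τ =
Δ^(1/(s-1)); a clique on about τ vertices has degrees about Δ, and a set I has codegree about
τ^(s-|I|) in it.

Suppose first that for at least half of the edges no subset I exceeds this codegree. Map V at random
into t ≈ τ points carrying an s-graph J without short Berge cycles, obtained from the girth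
hypothesis by shrinking r-edges to s vertices. Keep the edges sent onto an edge of J that is not
also the image of another edge meeting them. A short Berge cycle of kept edges would give a
nonbacktracking closed walk in J, hence a short Berge cycle there. On average at least half of the
edges sent into J are kept (`exists_sunflowerClosed_of_map`).

Otherwise more than half of the edges contain a marked set I of larger codegree, and |I| ≥ 2 because
degrees are at most Δ. By pigeonhole |I| = i, and the codegrees lie between D and 2D. Sampling
marked sets at rate about D/Δ isolates them and brings degrees down to 3D
(`exists_isolated_marked`). Contracting them (`exists_contraction`) gives an (s-i+1)-graph, to which
induction applies. The yield (D/Δ) D^(-1 + 1/((s-i)k)) is large enough since 2D ≥ τ^(s-i).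
Contraction may merge connecting vertices of a cycle, so the induction carries `SunflowerClosed`,
which tolerates repeated connecting vertices and pulls back along the contraction.

Upper bound. In a free r-graph every edge owns a pair of vertices lying in no other edge
(`IsFree.exists_own_pair`). These pairs form a graph with equally many edges and no cycle of length
at most ℓ, so the Moore bound (`pow_le_card_of_not_hasBerge`) gives O(n^(1+1/k)) edges. -/

/-! ### Berge cycles as closed sequences of vertices and edges -/

/-- `G` contains a Berge cycle of length `k`, given by its vertices and its edges in order. -/
def HasBerge {V : Type*} (G : Finset (Finset V)) (k : ℕ) : Prop :=
  ∃ (v : ℕ → V) (e : ℕ → Finset V), Set.InjOn v (Set.Iio k) ∧ Set.InjOn e (Set.Iio k) ∧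
    v k = v 0 ∧ ∀ i < k, e i ∈ G ∧ v i ∈ e i ∧ v (i + 1) ∈ e i

/-- The edges of every closed sequence of at most `ℓ` distinct edges, in which consecutive edges
meet, form a sunflower. The connecting vertices may be repeated. -/
def SunflowerClosed {V : Type*} [DecidableEq V] (ℓ : ℕ) (G : Finset (Finset V)) : Prop :=
  ∀ (k : ℕ) (v : ℕ → V) (e : ℕ → Finset V), 2 ≤ k → k ≤ ℓ → Set.InjOn e (Set.Iio k) →
    v k = v 0 → (∀ i < k, e i ∈ G ∧ v i ∈ e i ∧ v (i + 1) ∈ e i) →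
      ∃ K : Finset V, ∀ i < k, ∀ j < k, i ≠ j → e i ∩ e j = K

theorem exists_subset_isBergeCycle {V : Type*} {G : Finset (Finset V)} {k r : ℕ}
    (hG : IsUniform r G) (hk : 2 ≤ k) (v : ℕ → V) (e : ℕ → Finset V)
    (hv : Set.InjOn v (Set.Iio k)) (he : Set.InjOn e (Set.Iio k)) (hc : v k = v 0)
    (h : ∀ i < k, e i ∈ G ∧ v i ∈ e i ∧ v (i + 1) ∈ e i) :
    ∃ F ⊆ G, IsBergeCycle r k F ∧ ∀ f, f ∈ F ↔ ∃ i < k, e i = f := by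
  classical
  have hmem : ∀ f, f ∈ (Finset.range k).image e ↔ ∃ i < k, e i = f := by simp
  have hsub : (Finset.range k).image e ⊆ G := by
    intro f hf
    obtain ⟨i, hi, rfl⟩ := (hmem f).1 hf
    exact (h i hi).1
  refine ⟨(Finset.range k).image e, hsub, ⟨fun f hf => hG f (hsub hf), ?_⟩, hmem⟩
  refine ⟨⟨fun i => v i, fun i j hij => Fin.ext (hv i.2 j.2 hij)⟩,
    Equiv.ofBijective (fun i => ⟨e i, (hmem _).2 ⟨i, i.2, rfl⟩⟩) ⟨?_, ?_⟩, ?_⟩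
  · intro i j hij
    exact Fin.ext (he i.2 j.2 (Subtype.ext_iff.1 hij))
  · rintro ⟨f, hf⟩
    obtain ⟨i, hi, rfl⟩ := (hmem f).1 hf
    exact ⟨⟨i, hi⟩, rfl⟩
  · intro i x hx
    obtain ⟨n, rfl⟩ : ∃ n, k = n + 1 := ⟨k - 1, by omega⟩
    obtain ⟨y, hy, rfl⟩ := Finset.mem_map.1 hx
    simp only [cycleEdges, Finset.mem_insert, Finset.mem_singleton, finRotate_apply] at hy
    change v y ∈ e i
    rcases hy with rfl | rfl
    · exact (h y y.2).2.1
    · rw [Fin.val_add_one]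
      split_ifs with hi
      · have := (h i i.2).2.2
        rw [hi] at this ⊢
        simpa [hc] using this
      · exact (h i i.2).2.2

theorem exists_seq_of_isBergeCycle {V : Type*} {F : Finset (Finset V)} {k r : ℕ} (hk : 2 ≤ k)
    (hF : IsBergeCycle r k F) :
    ∃ (v : ℕ → V) (e : ℕ → Finset V), Set.InjOn v (Set.Iio k) ∧ Set.InjOn e (Set.Iio k) ∧
      v k = v 0 ∧ (∀ i < k, e i ∈ F ∧ v i ∈ e i ∧ v (i + 1) ∈ e i) ∧
      ∀ f ∈ F, ∃ i < k, e i = f := by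
  obtain ⟨-, f, φ, h⟩ := hF
  obtain ⟨n, rfl⟩ : ∃ n, k = n + 1 := ⟨k - 1, by omega⟩
  have hval : ∀ i < n + 1, ((Fin.ofNat (n + 1) i : Fin (n + 1)) : ℕ) = i := fun i hi => by
    simp [Nat.mod_eq_of_lt hi]
  refine ⟨fun i => f (Fin.ofNat _ i), fun i => φ (Fin.ofNat _ i), ?_, ?_, ?_, ?_, ?_⟩
  · intro i hi j hj hij
    rw [← hval i hi, ← hval j hj, f.injective hij]
  · intro i hi j hj hij
    rw [← hval i hi, ← hval j hj, φ.injective (Subtype.ext hij)]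
  · change f _ = f _
    congr 1
    apply Fin.ext
    simp
  · intro i hi
    have h1 := h (Fin.ofNat _ i)
    refine ⟨(φ _).2, h1 (Finset.mem_map_of_mem _ ?_), h1 (Finset.mem_map_of_mem _ ?_)⟩
    · simp [cycleEdges]
    · simp only [cycleEdges, finRotate_apply, Finset.mem_insert]
      right
      rw [Finset.mem_singleton]
      apply Fin.ext
      simp [Fin.val_add]
  · intro g hg
    refine ⟨φ.symm ⟨g, hg⟩, Fin.is_lt _, ?_⟩
    simp

theorem SunflowerClosed.isFree {V : Type*} [DecidableEq V] {ℓ : ℕ} {G : Finset (Finset V)}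
    (hG : SunflowerClosed ℓ G) (r : ℕ) : IsFree (IsShortNonSunflowerBergeCycle r ℓ) G := by
  rintro F hF ⟨⟨k, hk, hkl, hB⟩, hns⟩
  obtain ⟨v, e, -, he, hc, h, hsurj⟩ := exists_seq_of_isBergeCycle hk hB
  obtain ⟨K, hK⟩ := hG k v e hk hkl he hc fun i hi => ⟨hF (h i hi).1, (h i hi).2⟩
  refine hns ⟨K, fun a ha b hb hab => ?_⟩
  obtain ⟨i, hi, rfl⟩ := hsurj a ha
  obtain ⟨j, hj, rfl⟩ := hsurj b hb
  exact hK i hi j hj fun hij => hab (by rw [hij])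

theorem not_hasBerge_of_isFree {V : Type*} {ℓ r k : ℕ} {G : Finset (Finset V)}
    (hG : IsFree (IsShortBergeCycle r ℓ) G) (hu : IsUniform r G) (hk : 2 ≤ k) (hkl : k ≤ ℓ) :
    ¬ HasBerge G k := by
  rintro ⟨v, e, hv, he, hc, h⟩
  obtain ⟨F, hF, hB, -⟩ := exists_subset_isBergeCycle hu hk v e hv he hc h
  exact hG F hF ⟨k, hk, hkl, hB⟩

theorem hasBerge_two {V : Type*} {G : Finset (Finset V)} {a b : Finset V} (ha : a ∈ G)
    (hb : b ∈ G) (hab : a ≠ b) {x y : V} (hxy : x ≠ y) (hxa : x ∈ a) (hxb : x ∈ b) (hya : y ∈ a)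
    (hyb : y ∈ b) : HasBerge G 2 := by
  refine ⟨fun i => if i = 1 then y else x, fun i => if i = 1 then b else a, ?_, ?_, by simp, ?_⟩
  · intro i hi j hj hij
    simp only [Set.mem_Iio] at hi hj
    interval_cases i <;> interval_cases j <;> simp_all
  · intro i hi j hj hij
    simp only [Set.mem_Iio] at hi hj
    interval_cases i <;> interval_cases j <;> simp_all
  · intro i hi
    interval_cases i <;> simp_all

/-! ### Short Berge cycles from closed walks, and the sunflower property -/

/-- Take the smallest gap d at which a vertex or an edge of the walk repeats. The stretch between
the two occurrences has distinct vertices and edges, and d ≥ 2 since consecutive ones differ. -/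
theorem exists_hasBerge_of_nonbacktracking {V : Type*} {G : Finset (Finset V)} {k : ℕ}
    (hk : 0 < k) (x : ℕ → V) (g : ℕ → Finset V)
    (h : ∀ i < k, g i ∈ G ∧ x i ∈ g i ∧ x (i + 1) ∈ g i)
    (hx : ∀ i < k, x i ≠ x (i + 1)) (hg : ∀ i, i + 1 < k → g i ≠ g (i + 1)) (hc : x k = x 0) :
    ∃ d, 2 ≤ d ∧ d ≤ k ∧ HasBerge G d := by
  classical
  let p : ℕ → Prop := fun d => 0 < d ∧
    ∃ i, (i + d ≤ k ∧ x i = x (i + d)) ∨ (i + d < k ∧ g i = g (i + d))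
  have hp : ∃ d, p d := ⟨k, hk, 0, Or.inl ⟨by omega, by simp [hc]⟩⟩
  obtain ⟨hd0, i, hi⟩ := Nat.find_spec hp
  have hmin : ∀ m < Nat.find hp, ¬ p m := fun m hm => Nat.find_min hp hm
  set d := Nat.find hp with hd
  have xinj : ∀ a b, a < b → b ≤ k → b - a < d → x a ≠ x b := fun a b hab hb hlt he =>
    hmin (b - a) hlt ⟨by omega, a, Or.inl ⟨by omega, by rw [he]; congr 1; omega⟩⟩
  have ginj : ∀ a b, a < b → b < k → b - a < d → g a ≠ g b := fun a b hab hb hlt he =>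
    hmin (b - a) hlt ⟨by omega, a, Or.inr ⟨by omega, by rw [he]; congr 1; omega⟩⟩
  rcases hi with ⟨hik, hxi⟩ | ⟨hik, hgi⟩
  · have hd2 : 2 ≤ d := by
      by_contra hlt
      have : d = 1 := by omega
      rw [this] at hxi
      exact hx i (by omega) hxi
    refine ⟨d, hd2, by omega, fun j => x (i + j), fun j => g (i + j), ?_, ?_, ?_, ?_⟩
    · intro a ha b hb hab
      simp only [Set.mem_Iio] at ha hb
      rcases lt_trichotomy a b with hlt | heq | hlt
      · exact absurd hab (xinj _ _ (by omega) (by omega) (by omega))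
      · exact heq
      · exact absurd hab.symm (xinj _ _ (by omega) (by omega) (by omega))
    · intro a ha b hb hab
      simp only [Set.mem_Iio] at ha hb
      rcases lt_trichotomy a b with hlt | heq | hlt
      · exact absurd hab (ginj _ _ (by omega) (by omega) (by omega))
      · exact heq
      · exact absurd hab.symm (ginj _ _ (by omega) (by omega) (by omega))
    · simp [hxi]
    · intro j hj
      exact h (i + j) (by omega)
  · have hd2 : 2 ≤ d := by
      by_contra hlt
      have : d = 1 := by omega
      rw [this] at hgi hik
      exact hg i hik hgi
    -- When the edge repeats, g i is dropped: the last edge g (i + d) = g i contains x (i + 1) and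
    -- closes the cycle through x (i + 1), …, x (i + d).
    refine ⟨d, hd2, by omega, fun j => if j = d then x (i + 1) else x (i + 1 + j),
      fun j => g (i + 1 + j), ?_, ?_, ?_, ?_⟩
    · intro a ha b hb hab
      simp only [Set.mem_Iio] at ha hb
      beta_reduce at hab
      rw [if_neg (by omega), if_neg (by omega)] at hab
      rcases lt_trichotomy a b with hlt | heq | hlt
      · exact absurd hab (xinj _ _ (by omega) (by omega) (by omega))
      · exact heq
      · exact absurd hab.symm (xinj _ _ (by omega) (by omega) (by omega))
    · intro a ha b hb hab
      simp only [Set.mem_Iio] at ha hb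
      rcases lt_trichotomy a b with hlt | heq | hlt
      · exact absurd hab (ginj _ _ (by omega) (by omega) (by omega))
      · exact heq
      · exact absurd hab.symm (ginj _ _ (by omega) (by omega) (by omega))
    · simp
    · intro j hj
      have h1 := h (i + 1 + j) (by omega)
      refine ⟨h1.1, ?_, ?_⟩
      · beta_reduce
        rw [if_neg (by omega)]
        exact h1.2.1
      · beta_reduce
        by_cases hjd : j + 1 = d
        · rw [if_pos hjd, show i + 1 + j = i + d by omega, ← hgi]
          exact (h i (by omega)).2.2
        · rw [if_neg hjd]
          exact h1.2.2

/-- If a vertex repeats, at positions a < b, the sequence splits there into two shorter closed ones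
with distinct edges, and not both can be constant at that vertex. -/
theorem exists_hasBerge_of_closed {V : Type*} {G : Finset (Finset V)} (k : ℕ) :
    ∀ (v : ℕ → V) (e : ℕ → Finset V), Set.InjOn e (Set.Iio k) → v k = v 0 →
      (∀ i < k, e i ∈ G ∧ v i ∈ e i ∧ v (i + 1) ∈ e i) → (∃ i < k, v i ≠ v 0) →
      ∃ d, 2 ≤ d ∧ d ≤ k ∧ HasBerge G d := by
  induction k using Nat.strong_induction_on with
  | _ k ih =>
  intro v e he hc h hne
  by_cases hv : Set.InjOn v (Set.Iio k)
  · obtain ⟨i, hi, hvi⟩ := hne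
    have : i ≠ 0 := fun h0 => hvi (by rw [h0])
    exact ⟨k, by omega, le_rfl, v, e, hv, he, hc, h⟩
  obtain ⟨a, b, hab, hbk, hvab⟩ : ∃ a b, a < b ∧ b < k ∧ v a = v b := by
    simp only [Set.InjOn, not_forall] at hv
    obtain ⟨a, ha, b, hb, hvab, hne⟩ := hv
    rcases lt_or_gt_of_ne hne with hlt | hlt
    · exact ⟨a, b, hlt, hb, hvab⟩
    · exact ⟨b, a, hlt, ha, hvab.symm⟩
  by_cases h1 : ∃ i < b - a, v (a + i) ≠ v a
  · obtain ⟨d, hd2, hd, hB⟩ := ih (b - a) (by omega) (fun i => v (a + i)) (fun i => e (a + i))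
      (fun i hi j hj hij => by
        simp only [Set.mem_Iio] at hi hj
        have := he (show a + i ∈ Set.Iio k by simp; omega)
          (show a + j ∈ Set.Iio k by simp; omega) hij
        omega)
      (by simp only [Nat.add_zero]; rw [hvab]; congr 1; omega)
      (fun i hi => h (a + i) (by omega)) (by simpa using h1)
    exact ⟨d, hd2, by omega, hB⟩
  push Not at h1
  -- The stretch from a to b is constant, so it is cut out and the remainder is still nonconstant.
  obtain ⟨d, hd2, hd, hB⟩ := ih (k - (b - a)) (by omega)
      (fun i => if i ≤ a then v i else v (i + (b - a)))
      (fun i => if i < a then e i else e (i + (b - a)))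
      (fun i hi j hj hij => by
        simp only [Set.mem_Iio] at hi hj
        have key : ∀ p < k, ∀ q < k, e p = e q → p = q := fun p hp q hq hpq => he hp hq hpq
        simp only at hij
        split_ifs at hij with h2 h3 h3
        · exact key _ (by omega) _ (by omega) hij
        · have := key _ (by omega) _ (by omega) hij
          omega
        · have := key _ (by omega) _ (by omega) hij
          omega
        · have := key _ (by omega) _ (by omega) hij
          omega)
      (by
        simp only [Nat.zero_le, if_true]
        rw [if_neg (by omega), ← hc]
        congr 1
        omega)
      (fun i hi => by
        rcases lt_trichotomy i a with hlt | heq | hlt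
        · have := h i (by omega)
          simp only [if_pos hlt, if_pos hlt.le, if_pos (show i + 1 ≤ a from hlt)]
          exact this
        · subst heq
          have := h (i + (b - i)) (by omega)
          rw [show i + (b - i) = b by omega, ← hvab] at this
          simp only [lt_irrefl, if_false, le_refl, if_true, if_neg (show ¬ i + 1 ≤ i by omega)]
          rw [show i + (b - i) = b by omega, show i + 1 + (b - i) = b + 1 by omega]
          exact this
        · have := h (i + (b - a)) (by omega)
          simp only [if_neg (show ¬ i < a by omega), if_neg (show ¬ i ≤ a by omega),
            if_neg (show ¬ i + 1 ≤ a by omega)]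
          rw [show i + 1 + (b - a) = i + (b - a) + 1 by omega]
          exact this)
      (by
        by_contra hall
        push Not at hall
        simp only [Nat.zero_le, if_true] at hall
        have ha0 : v a = v 0 := by simpa using hall a (by omega)
        obtain ⟨i, hi, hvi⟩ := hne
        apply hvi
        rcases le_or_gt i a with h2 | h2
        · simpa [h2] using hall i (by omega)
        · rcases lt_or_ge i b with h3 | h3
          · rw [← ha0, ← h1 (i - a) (by omega)]
            congr 1
            omega
          · rcases eq_or_lt_of_le h3 with h4 | h4
            · rw [← h4, ← hvab, ha0]
            · have := hall (i - (b - a)) (by omega)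
              rw [if_neg (by omega)] at this
              rw [← this]
              congr 1
              omega)
  exact ⟨d, hd2, by omega, hB⟩

/-- All connecting vertices must coincide, and without Berge 2-cycles two edges share nothing beyond
that vertex, which is therefore the kernel. -/
theorem sunflowerClosed_of_not_hasBerge {V : Type*} [DecidableEq V] {ℓ : ℕ}
    {G : Finset (Finset V)} (hG : ∀ d, 2 ≤ d → d ≤ ℓ → ¬ HasBerge G d) : SunflowerClosed ℓ G := by
  intro k v e hk hkl he hc h
  have hall : ∀ i < k, v i = v 0 := by
    by_contra hne
    push Not at hne
    obtain ⟨d, hd2, hd, hB⟩ := exists_hasBerge_of_closed k v e he hc h hne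
    exact hG d hd2 (hd.trans hkl) hB
  refine ⟨{v 0}, fun i hi j hj hij => ?_⟩
  ext x
  have hi0 : v 0 ∈ e i := hall i hi ▸ (h i hi).2.1
  have hj0 : v 0 ∈ e j := hall j hj ▸ (h j hj).2.1
  simp only [Finset.mem_inter, Finset.mem_singleton]
  constructor
  · rintro ⟨hxi, hxj⟩
    by_contra hx
    exact hG 2 le_rfl (hk.trans hkl) (hasBerge_two (h i hi).1 (h j hj).1
      (fun hee => hij (he hi hj hee)) hx hxi hxj hi0 hj0)
  · rintro rfl
    exact ⟨hi0, hj0⟩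

/-- The image of a Berge cycle of `G` is a nonbacktracking closed walk in `J`: `f` separates the
vertices of each edge, and consecutive edges meet, so `hdisj` separates their images. Hence `G` has
no short Berge cycle at all. -/
theorem sunflowerClosed_of_map {V W : Type*} [DecidableEq V] [DecidableEq W] {ℓ : ℕ}
    {G : Finset (Finset V)} {J : Finset (Finset W)}
    (hJ : ∀ d, 2 ≤ d → d ≤ ℓ → ¬ HasBerge J d) (f : V → W)
    (hf : ∀ e ∈ G, e.image f ∈ J ∧ Set.InjOn f e)
    (hdisj : ∀ e ∈ G, ∀ e' ∈ G, e' ≠ e → ¬ Disjoint e e' → e'.image f ≠ e.image f) :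
    SunflowerClosed ℓ G := by
  refine sunflowerClosed_of_not_hasBerge fun k hk hkl => ?_
  rintro ⟨v, e, hv, he, hc, h⟩
  obtain ⟨d, hd2, hd, hB⟩ := exists_hasBerge_of_nonbacktracking (G := J) (k := k) (by omega)
    (fun i => f (v i)) (fun i => (e i).image f)
    (fun i hi => ⟨(hf _ (h i hi).1).1, Finset.mem_image_of_mem _ (h i hi).2.1,
      Finset.mem_image_of_mem _ (h i hi).2.2⟩)
    (fun i hi hxx => by
      have hvv := (hf _ (h i hi).1).2 (h i hi).2.1 (h i hi).2.2 hxx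
      rcases Nat.lt_or_ge (i + 1) k with hlt | hge
      · have := hv hi hlt hvv
        omega
      · have hik : i + 1 = k := by omega
        rw [hik, hc] at hvv
        have := hv hi (show 0 ∈ Set.Iio k by simp; omega) hvv
        omega)
    (fun i hi hgg => by
      refine hdisj _ (h (i + 1) hi).1 _ (h i (by omega)).1 (fun hee => ?_) ?_ hgg
      · have := he (show i ∈ Set.Iio k by simp; omega) (show i + 1 ∈ Set.Iio k from hi) hee
        omega
      · rw [Finset.not_disjoint_iff]
        exact ⟨v (i + 1), (h (i + 1) hi).2.1, (h i (by omega)).2.2⟩)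
    (by simp [hc])
  exact hJ d hd2 (hd.trans hkl) hB

/-- By `hπ` every edge is a union of fibres of `π`, so intersections of edges are preimages of
intersections of their images, and a kernel pulls back to a kernel. The connecting vertices may
become equal under `π`. -/
theorem SunflowerClosed.of_image {V : Type*} [Fintype V] [DecidableEq V] {ℓ : ℕ}
    {G : Finset (Finset V)} (π : V → V) (hπ : ∀ e ∈ G, ∀ x, π x ∈ e.image π → x ∈ e)
    (hG : SunflowerClosed ℓ (G.image (Finset.image π))) : SunflowerClosed ℓ G := by
  have hiff : ∀ e ∈ G, ∀ x, x ∈ e ↔ π x ∈ e.image π := fun e he x =>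
    ⟨fun hx => Finset.mem_image_of_mem _ hx, hπ e he x⟩
  intro k v e hk hkl he hc h
  obtain ⟨K, hK⟩ := hG k (fun i => π (v i)) (fun i => (e i).image π) hk hkl
    (fun i hi j hj hij => he hi hj (by
      ext x
      rw [hiff _ (h i hi).1, hiff _ (h j hj).1]
      simp only at hij
      rw [hij]))
    (by simp [hc])
    (fun i hi => ⟨Finset.mem_image_of_mem _ (h i hi).1, Finset.mem_image_of_mem _ (h i hi).2.1,
      Finset.mem_image_of_mem _ (h i hi).2.2⟩)
  refine ⟨Finset.univ.filter fun x => π x ∈ K, fun i hi j hj hij => ?_⟩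
  ext x
  rw [Finset.mem_inter, hiff _ (h i hi).1, hiff _ (h j hj).1, ← Finset.mem_inter,
    hK i hi j hj hij]
  simp

/-! ### Counting forms of the probabilistic estimates -/

-- For a uniformly random `f`, the value f x is independent of `Q` and `S`, so it falls into `S f`
-- with probability at most s / t. The proof double counts pairs (f, f') where f' resamples f at x.
open Finset in
theorem card_filter_mem_mul_le {V : Type*} [Fintype V] [DecidableEq V] {t s : ℕ} (x : V)
    (Q : (V → Fin t) → Prop) [DecidablePred Q] (S : (V → Fin t) → Finset (Fin t))
    (hQ : ∀ f a, Q f → Q (Function.update f x a)) (hS : ∀ f a, S (Function.update f x a) = S f)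
    (hs : ∀ f, Q f → (S f).card ≤ s) :
    (univ.filter fun f => Q f ∧ f x ∈ S f).card * t ≤ (univ.filter Q).card * s := by
  classical
  refine card_mul_le_card_mul (fun f f' : V → Fin t => ∃ a, f' = Function.update f x a) ?_ ?_
  · intro f hf
    simp only [mem_filter, mem_univ, true_and] at hf
    have hsub : (univ.image fun a => Function.update f x a) ⊆
        bipartiteAbove (fun f f' : V → Fin t => ∃ a, f' = Function.update f x a)
          (univ.filter Q) f := by
      intro f' hf'
      obtain ⟨a, -, rfl⟩ := mem_image.1 hf'
      simp only [mem_bipartiteAbove, mem_filter, mem_univ, true_and]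
      exact ⟨hQ f a hf.1, a, rfl⟩
    have := card_le_card hsub
    rwa [card_image_of_injective _ (Function.update_injective f x), card_univ,
      Fintype.card_fin] at this
  · intro f' hf'
    simp only [mem_filter, mem_univ, true_and] at hf'
    refine le_trans (card_le_card (t := (S f').image fun a => Function.update f' x a) ?_)
      (card_image_le.trans (hs f' hf'))
    intro f hf
    simp only [mem_bipartiteBelow, mem_filter, mem_univ, true_and] at hf
    obtain ⟨⟨-, hfS⟩, a, rfl⟩ := hf
    rw [mem_image]
    exact ⟨f x, by rwa [hS], by simp⟩

open Finset in
/-- Forcing the values on a set `D` of coordinates into a set of size `s` costs a factor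
`(s / t) ^ |D|`. -/
theorem card_filter_forall_mem_mul_le {V : Type*} [Fintype V] [DecidableEq V] {t s : ℕ}
    (D : Finset V) (Q : (V → Fin t) → Prop) [DecidablePred Q]
    (S : (V → Fin t) → Finset (Fin t))
    (hQ : ∀ f, ∀ x ∈ D, ∀ a, Q f → Q (Function.update f x a))
    (hS : ∀ f, ∀ x ∈ D, ∀ a, S (Function.update f x a) = S f)
    (hs : ∀ f, Q f → (S f).card ≤ s) :
    (univ.filter fun f => Q f ∧ ∀ x ∈ D, f x ∈ S f).card * t ^ D.card ≤
      (univ.filter Q).card * s ^ D.card := by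
  classical
  induction D using Finset.induction_on with
  | empty => simp
  | insert x D hx ih =>
    have h1 := card_filter_mem_mul_le x (fun f => Q f ∧ ∀ y ∈ D, f y ∈ S f) S (s := s)
      (fun f a ⟨hf, hfD⟩ => ⟨hQ f x (mem_insert_self _ _) a hf, fun y hy => by
        rw [Function.update_of_ne (ne_of_mem_of_not_mem hy hx), hS f x (mem_insert_self _ _)]
        exact hfD y hy⟩)
      (fun f a => hS f x (mem_insert_self _ _) a) (fun f hf => hs f hf.1)
    have h2 := ih (fun f y hy => hQ f y (mem_insert_of_mem hy))
      (fun f y hy => hS f y (mem_insert_of_mem hy))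
    have h3 : (univ.filter fun f => Q f ∧ ∀ y ∈ insert x D, f y ∈ S f) =
        univ.filter fun f => (Q f ∧ ∀ y ∈ D, f y ∈ S f) ∧ f x ∈ S f := by
      ext f
      simp only [mem_filter, mem_univ, true_and, mem_insert, forall_eq_or_imp]
      tauto
    rw [h3, card_insert_of_notMem hx, pow_succ', pow_succ']
    calc _ = _ * t * t ^ D.card := by ring
      _ ≤ _ * s * t ^ D.card := Nat.mul_le_mul_right _ h1
      _ = s * (_ * t ^ D.card) := by ring
      _ ≤ s * (_ * s ^ D.card) := Nat.mul_le_mul_left _ h2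
      _ = _ := by ring

open Finset in
/-- The expected number of edges of `J` hit by a fixed edge under a random map. -/
theorem card_mul_le_card_filter_image_mem {V : Type*} [Fintype V] [DecidableEq V] {t s : ℕ}
    {J : Finset (Finset (Fin t))} (hJ : IsUniform s J) {e : Finset V} (he : e.card = s) :
    J.card * Fintype.card (V → Fin t) ≤
      t ^ s * (univ.filter fun f : V → Fin t => e.image f ∈ J).card := by
  classical
  have hσ : ∀ g : {g // g ∈ J}, Nonempty (e ≃ g.1) := fun g =>
    ⟨Finset.equivOfCardEq (he.trans (hJ g g.2).symm)⟩
  let σ : ∀ g : {g // g ∈ J}, e ≃ g.1 := fun g => (hσ g).some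
  -- Overwrite a map on e by one fixed bijection onto g. The result determines g and the values off
  -- e, so only the t ^ s overwritten values are lost. Using a single bijection per g costs a factor
  -- s!, which is harmless.
  let F : {g // g ∈ J} × (V → Fin t) → (V → Fin t) := fun p x =>
    if h : x ∈ e then (σ p.1 ⟨x, h⟩ : Fin t) else p.2 x
  have himg : ∀ p, e.image (F p) = p.1 := by
    intro p
    ext y
    simp only [mem_image]
    constructor
    · rintro ⟨x, hx, rfl⟩
      simp only [F, dif_pos hx]
      exact (σ p.1 ⟨x, hx⟩).2
    · intro hy
      refine ⟨(σ p.1).symm ⟨y, hy⟩, ((σ p.1).symm ⟨y, hy⟩).2, ?_⟩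
      simp [F]
  have h1 := card_le_mul_card_image_of_maps_to (s := (univ : Finset ({g // g ∈ J} × (V → Fin t))))
    (t := univ.filter fun f : V → Fin t => e.image f ∈ J) (f := F)
    (fun p _ => by simp [himg]) (t ^ s) ?_
  · rwa [card_univ, Fintype.card_prod, Fintype.card_coe] at h1
  · intro f _
    have h2 := card_le_card_of_injOn (s := univ.filter fun p => F p = f)
      (t := (univ : Finset (e → Fin t))) (fun p x => p.2 x) (fun _ _ => mem_univ _) ?_
    · refine h2.trans ?_
      rw [card_univ, Fintype.card_fun, Fintype.card_coe, he, Fintype.card_fin]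
    · intro p hp q hq hpq
      simp only [coe_filter, mem_univ, true_and, Set.mem_ofPred_eq] at hp hq
      have hp1 : p.1 = q.1 := Subtype.ext (by rw [← himg p, ← himg q, hp, hq])
      refine Prod.ext hp1 (funext fun x => ?_)
      by_cases hx : x ∈ e
      · exact congrFun hpq ⟨x, hx⟩
      · have := congrFun (hp.trans hq.symm) x
        simpa [F, hx] using this

open Finset in
/-- Random selection of labels: keeping one colour class of a random colouring with `M` colours. -/
theorem exists_selection {E X : Type*} [DecidableEq E] [Fintype X] [DecidableEq X] (S : Finset E)
    (I : E → X) (w : E → X → ℝ) (hw : ∀ e x, 0 ≤ w e x) {M : ℕ} (hM : 0 < M)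
    (hW : ∀ e ∈ S, 2 * ∑ x, w e x ≤ M) :
    ∃ T : Finset X, S.card ≤
      2 * M * (S.filter fun e => I e ∈ T ∧ ∑ x ∈ T.erase (I e), w e x < 1).card := by
  classical
  have hpair : ∀ x y : X, x ≠ y →
      ((univ.filter fun c : X → Fin M => c x = c y).card : ℝ) * M ≤
        Fintype.card (X → Fin M) := by
    intro x y hxy
    have := card_filter_mem_mul_le (t := M) (s := 1) x (fun _ => True) (fun c => {c y})
      (fun _ _ _ => trivial) (fun f a => by rw [Function.update_of_ne hxy.symm]) (by simp)
    simp only [true_and, mem_singleton, filter_true, card_univ, mul_one] at this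
    exact_mod_cast this
  -- Total weight of the other labels coloured like I e. Each shares that colour with probability at
  -- most 1 / M, so `hW` bounds the expected load by 1 / 2.
  let load : (X → Fin M) → E → ℝ := fun c e =>
    ∑ x ∈ univ.erase (I e), if c x = c (I e) then w e x else 0
  have hMr : (0 : ℝ) < M := by exact_mod_cast hM
  have : Nonempty (Fin M) := ⟨⟨0, hM⟩⟩
  have hE : ∀ e ∈ S, ∑ c, load c e ≤ (1 / 2) * Fintype.card (X → Fin M) := by
    intro e he
    simp only [load]
    rw [sum_comm]
    have h1 : ∀ x ∈ univ.erase (I e), ∑ c : X → Fin M, (if c x = c (I e) then w e x else 0) ≤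
        w e x * (Fintype.card (X → Fin M) / M) := by
      intro x hx
      rw [← sum_filter, sum_const, nsmul_eq_mul, mul_comm]
      refine mul_le_mul_of_nonneg_left ?_ (hw e x)
      rw [le_div_iff₀ hMr]
      exact hpair x (I e) (ne_of_mem_erase hx)
    refine (sum_le_sum h1).trans ?_
    rw [← sum_mul]
    have h2 : ∑ x ∈ univ.erase (I e), w e x ≤ M / 2 := by
      have := sum_le_sum_of_subset_of_nonneg (erase_subset (I e) univ)
        (fun x _ _ => hw e x)
      have := hW e he
      linarith
    refine (mul_le_mul_of_nonneg_right h2 (by positivity)).trans (le_of_eq ?_)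
    field_simp
  obtain ⟨c, -, hc⟩ : ∃ c ∈ (univ : Finset (X → Fin M)), ∑ e ∈ S, load c e ≤ (1 / 2) * S.card := by
    refine exists_le_of_sum_le univ_nonempty ?_
    rw [sum_comm, sum_const, card_univ, nsmul_eq_mul]
    calc _ ≤ ∑ e ∈ S, (1 / 2 : ℝ) * Fintype.card (X → Fin M) := sum_le_sum hE
      _ = _ := by rw [sum_const, nsmul_eq_mul]; ring
  have hload0 : ∀ e, 0 ≤ load c e := fun e => sum_nonneg fun x _ => by
    split_ifs
    · exact hw e x
    · exact le_rfl
  -- Markov's inequality: for the colouring c, at least half of `S` has load below 1.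
  have hhalf : S.card ≤ 2 * (S.filter fun e => load c e < 1).card := by
    have h1 : ((S.filter fun e => ¬ load c e < 1).card : ℝ) ≤ (1 / 2) * S.card := by
      refine le_trans ?_ hc
      refine le_trans ?_ (sum_le_sum_of_subset_of_nonneg
        (filter_subset (fun e => ¬ load c e < 1) S) fun e _ _ => hload0 e)
      rw [← nsmul_one, ← sum_const]
      exact sum_le_sum fun e he => not_lt.1 (mem_filter.1 he).2
    have h2 : ((S.filter fun e => load c e < 1).card : ℝ) +
        (S.filter fun e => ¬ load c e < 1).card = S.card := by
      exact_mod_cast card_filter_add_card_filter_not (s := S) (fun e => load c e < 1)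
    have h3 : (S.card : ℝ) ≤ 2 * (S.filter fun e => load c e < 1).card := by linarith
    exact_mod_cast h3
  obtain ⟨a, -, ha⟩ : ∃ a ∈ (univ : Finset (Fin M)), (S.filter fun e => load c e < 1).card ≤
      M * ((S.filter fun e => load c e < 1).filter fun e => c (I e) = a).card := by
    by_contra! hcon
    have h1 := card_eq_sum_card_fiberwise (f := fun e => c (I e))
      (s := S.filter fun e => load c e < 1) (t := univ) (fun _ _ => mem_coe.2 (mem_univ _))
    have h2 := sum_lt_sum_of_nonempty (univ_nonempty (α := Fin M)) hcon
    rw [← mul_sum, ← h1, sum_const, card_univ, Fintype.card_fin, smul_eq_mul] at h2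
    exact lt_irrefl _ h2
  refine ⟨univ.filter fun x => c x = a, ?_⟩
  have hsub : ((S.filter fun e => load c e < 1).filter fun e => c (I e) = a) ⊆
      S.filter fun e => I e ∈ (univ.filter fun x => c x = a) ∧
        ∑ x ∈ (univ.filter fun x => c x = a).erase (I e), w e x < 1 := by
    intro e he
    simp only [mem_filter, mem_univ, true_and] at he ⊢
    refine ⟨he.1.1, he.2, lt_of_eq_of_lt ?_ he.1.2⟩
    simp only [load]
    rw [← sum_filter, he.2]
    congr 1
    ext x
    simp [and_comm]
  calc S.card ≤ _ := hhalf
    _ ≤ 2 * (M * _) := Nat.mul_le_mul_left _ (ha.trans (Nat.mul_le_mul_left _ (card_le_card hsub)))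
    _ = _ := by ring

/-! ### Small codegrees: random maps into a hypergraph of large girth -/

/-- The codegree of a set of vertices: the number of edges containing it. -/
def codegree {V : Type*} [DecidableEq V] (H : Finset (Finset V)) (I : Finset V) : ℕ :=
  (H.filter (fun e => I ⊆ e)).card

-- An edge lands in `J` with probability at least |J| / t^s. Given this, another edge e' has the
-- same image only if all of e' \ e falls into the image of e, which has probability at most
-- (s/t)^|e' \ e|. By `hcod` and the union bound, at least half of the successful maps are free of
-- collisions at e.
open Finset in
theorem exists_sunflowerClosed_of_map {V : Type*} [Fintype V] [DecidableEq V] {ℓ s t : ℕ}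
    (ht : 0 < t) {J : Finset (Finset (Fin t))} (hJs : IsUniform s J)
    (hJ : ∀ d, 2 ≤ d → d ≤ ℓ → ¬ HasBerge J d) {H : Finset (Finset V)} (hH : IsUniform s H)
    (hcod : ∀ e ∈ H, ∑ e' ∈ H.filter (fun e' => e' ≠ e ∧ ¬ Disjoint e e'),
      ((s : ℝ) / t) ^ (e' \ e).card ≤ 1 / 2) :
    ∃ G ⊆ H, SunflowerClosed ℓ G ∧ (H.card : ℝ) * J.card ≤ 2 * t ^ s * G.card := by
  classical
  have htr : (0 : ℝ) < t := by exact_mod_cast ht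
  let good : (V → Fin t) → Finset V → Prop := fun f e => e.image f ∈ J ∧
    ∀ e' ∈ H, e' ≠ e → ¬ Disjoint e e' → e'.image f ≠ e.image f
  let A : Finset V → Finset (V → Fin t) := fun e => univ.filter fun f => e.image f ∈ J
  let bad : Finset V → Finset V → Finset (V → Fin t) := fun e e' =>
    univ.filter fun f => e.image f ∈ J ∧ e'.image f = e.image f
  have hbad : ∀ e ∈ H, ∀ e' ∈ H,
      ((bad e e').card : ℝ) ≤ (A e).card * ((s : ℝ) / t) ^ (e' \ e).card := by
    intro e he e' he'
    have himg : ∀ f : V → Fin t, ∀ x ∈ e' \ e, ∀ a,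
        e.image (Function.update f x a) = e.image f := fun f x hx a =>
      image_congr fun y hy => Function.update_of_ne
        (ne_of_mem_of_not_mem hy (mem_sdiff.1 hx).2) _ _
    have h1 := card_filter_forall_mem_mul_le (s := s) (e' \ e)
      (fun f : V → Fin t => e.image f ∈ J) (fun f => e.image f)
      (fun f x hx a hf => by rwa [himg f x hx a]) himg
      (fun f _ => card_image_le.trans (hH e he).le)
    have h2 : (bad e e').card ≤ (univ.filter fun f : V → Fin t => e.image f ∈ J ∧
        ∀ x ∈ e' \ e, f x ∈ e.image f).card := by
      refine card_le_card fun f hf => ?_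
      simp only [bad, mem_filter, mem_univ, true_and] at hf ⊢
      exact ⟨hf.1, fun x hx => hf.2 ▸ mem_image_of_mem f (mem_sdiff.1 hx).1⟩
    have h3 : ((bad e e').card : ℝ) * t ^ (e' \ e).card ≤ (A e).card * s ^ (e' \ e).card := by
      exact_mod_cast (Nat.mul_le_mul_right _ h2).trans h1
    rw [div_pow, ← mul_div_assoc, le_div_iff₀ (by positivity)]
    exact h3
  have hgood : ∀ e ∈ H, ((A e).card : ℝ) ≤ 2 * (univ.filter fun f => good f e).card := by
    intro e he
    have h1 : A e ⊆ (univ.filter fun f => good f e) ∪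
        (H.filter fun e' => e' ≠ e ∧ ¬ Disjoint e e').biUnion (bad e) := by
      intro f hf
      simp only [A, mem_filter, mem_univ, true_and] at hf
      by_cases hg : good f e
      · exact mem_union_left _ (by simpa using hg)
      · simp only [good, hf, true_and, not_forall, not_not] at hg
        obtain ⟨e', he', hne, hd, himg⟩ := hg
        refine mem_union_right _ (mem_biUnion.2 ⟨e', mem_filter.2 ⟨he', hne, hd⟩, ?_⟩)
        simp only [bad, mem_filter, mem_univ, true_and]
        exact ⟨hf, himg⟩
    have h2 : ((A e).card : ℝ) ≤ (univ.filter fun f => good f e).card +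
        ∑ e' ∈ H.filter (fun e' => e' ≠ e ∧ ¬ Disjoint e e'), ((bad e e').card : ℝ) := by
      exact_mod_cast (card_le_card h1).trans ((card_union_le _ _).trans
        (Nat.add_le_add_left card_biUnion_le _))
    have h3 : ∑ e' ∈ H.filter (fun e' => e' ≠ e ∧ ¬ Disjoint e e'), ((bad e e').card : ℝ) ≤
        (A e).card * (1 / 2) := by
      refine (sum_le_sum fun e' he' => hbad e he e' (mem_filter.1 he').1).trans ?_
      rw [← mul_sum]
      exact mul_le_mul_of_nonneg_left (hcod e he) (by positivity)
    linarith
  have hA : ∀ e ∈ H, (J.card : ℝ) * Fintype.card (V → Fin t) ≤ t ^ s * (A e).card := by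
    intro e he
    exact_mod_cast card_mul_le_card_filter_image_mem hJs (hH e he)
  have : Nonempty (Fin t) := ⟨⟨0, ht⟩⟩
  obtain ⟨f, -, hf⟩ : ∃ f ∈ (univ : Finset (V → Fin t)),
      (H.card : ℝ) * J.card ≤ 2 * t ^ s * (H.filter (good f)).card := by
    refine exists_le_of_sum_le univ_nonempty ?_
    have h4 : ∑ f : V → Fin t, ((H.filter (good f)).card : ℝ) =
        ∑ e ∈ H, ((univ.filter fun f => good f e).card : ℝ) := by
      exact_mod_cast sum_card_bipartiteAbove_eq_sum_card_bipartiteBelow (s := univ) (t := H)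
        (fun f e => good f e)
    rw [← mul_sum univ (fun f : V → Fin t => ((H.filter (good f)).card : ℝ)), h4, sum_const, card_univ, nsmul_eq_mul, mul_sum]
    calc (Fintype.card (V → Fin t) : ℝ) * (H.card * J.card)
        = ∑ e ∈ H, (J.card : ℝ) * Fintype.card (V → Fin t) := by
          rw [sum_const, nsmul_eq_mul]; ring
      _ ≤ ∑ e ∈ H, 2 * (t : ℝ) ^ s * (univ.filter fun f => good f e).card := by
          refine sum_le_sum fun e he => (hA e he).trans ?_
          calc (t : ℝ) ^ s * (A e).card ≤ t ^ s * (2 * (univ.filter fun f => good f e).card) :=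
                mul_le_mul_of_nonneg_left (hgood e he) (by positivity)
            _ = _ := by ring
  refine ⟨H.filter (good f), filter_subset _ _, ?_, hf⟩
  refine sunflowerClosed_of_map hJ f (fun e he => ?_) (fun e he e' he' hne hd => ?_)
  · obtain ⟨heH, hg⟩ := mem_filter.1 he
    exact ⟨hg.1, card_image_iff.1 (by rw [hJs _ hg.1, hH e heH])⟩
  · exact (mem_filter.1 he).2.2 e' (mem_filter.1 he').1 hne hd

-- Group the edges e' by I = e ∩ e'. Each group contributes at most (τ s / t)^(s-|I|) ≤ 2^-(s+1),
-- and there are at most 2^s groups; this is the source of the constant in `htτ`.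
open Finset in
theorem sum_pow_card_sdiff_le {V : Type*} [DecidableEq V] {s t : ℕ} {τ : ℝ} (hτ : 0 ≤ τ)
    (ht : 0 < t) (htτ : 2 ^ (s + 1) * s * τ ≤ t) {H : Finset (Finset V)} (hH : IsUniform s H)
    {e : Finset V} (he : e ∈ H)
    (hcod : ∀ I ⊆ e, 1 ≤ I.card → I.card < s → (codegree H I : ℝ) ≤ τ ^ (s - I.card)) :
    ∑ e' ∈ H.filter (fun e' => e' ≠ e ∧ ¬ Disjoint e e'), ((s : ℝ) / t) ^ (e' \ e).card ≤
      1 / 2 := by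
  have htr : (0 : ℝ) < t := by exact_mod_cast ht
  set T := e.powerset.filter fun I => 1 ≤ I.card ∧ I.card < s with hT
  have hmaps : ∀ e' ∈ H.filter (fun e' => e' ≠ e ∧ ¬ Disjoint e e'), e ∩ e' ∈ T := by
    intro e' he'
    obtain ⟨he'H, hne, hd⟩ := mem_filter.1 he'
    refine mem_filter.2 ⟨mem_powerset.2 inter_subset_left, ?_, ?_⟩
    · rw [not_disjoint_iff_nonempty_inter] at hd
      exact card_pos.2 hd
    · rw [← hH e he]
      refine card_lt_card (Finset.ssubset_iff_subset_ne.2 ⟨inter_subset_left, fun h => hne ?_⟩)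
      exact (eq_of_subset_of_card_le (inter_eq_left.1 h) (by rw [hH e he, hH e' he'H])).symm
  have hq : τ * (s / t) ≤ (1 / 2) ^ (s + 1) := by
    rw [one_div, inv_pow, ← mul_div_assoc, div_le_iff₀ htr, inv_mul_eq_div,
      le_div_iff₀ (by positivity)]
    linarith
  have hq0 : 0 ≤ τ * (s / t) := by positivity
  rw [← sum_fiberwise_of_maps_to hmaps]
  have hI : ∀ I ∈ T, ∑ e' ∈ (H.filter (fun e' => e' ≠ e ∧ ¬ Disjoint e e')).filter
      (fun e' => e ∩ e' = I), ((s : ℝ) / t) ^ (e' \ e).card ≤ (1 / 2) ^ (s + 1) := by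
    intro I hI
    obtain ⟨hIe, hI1, hIs⟩ := mem_filter.1 hI
    rw [mem_powerset] at hIe
    have h1 : ∀ e' ∈ (H.filter (fun e' => e' ≠ e ∧ ¬ Disjoint e e')).filter
        (fun e' => e ∩ e' = I), ((s : ℝ) / t) ^ (e' \ e).card = (s / t) ^ (s - I.card) := by
      intro e' he'
      simp only [mem_filter] at he'
      rw [card_sdiff, hH e' he'.1.1, he'.2]
    rw [sum_congr rfl h1, sum_const, nsmul_eq_mul]
    have h2 : (((H.filter (fun e' => e' ≠ e ∧ ¬ Disjoint e e')).filter
        (fun e' => e ∩ e' = I)).card : ℝ) ≤ codegree H I := by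
      refine Nat.cast_le.2 (card_le_card fun e' he' => ?_)
      simp only [mem_filter] at he' ⊢
      exact ⟨he'.1.1, he'.2 ▸ inter_subset_right⟩
    calc _ ≤ τ ^ (s - I.card) * ((s : ℝ) / t) ^ (s - I.card) :=
          mul_le_mul_of_nonneg_right (h2.trans (hcod I hIe hI1 hIs)) (by positivity)
      _ = (τ * (s / t)) ^ (s - I.card) := (mul_pow _ _ _).symm
      _ ≤ (τ * (s / t)) ^ 1 := pow_le_pow_of_le_one hq0
          (hq.trans (pow_le_one₀ (by norm_num) (by norm_num))) (by omega)
      _ ≤ _ := by rwa [pow_one]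
  refine (sum_le_sum hI).trans ?_
  rw [sum_const, nsmul_eq_mul]
  have hTc : (T.card : ℝ) ≤ 2 ^ s := by
    have := card_le_card (filter_subset (fun I => 1 ≤ I.card ∧ I.card < s) e.powerset)
    rw [card_powerset, hH e he] at this
    exact_mod_cast this
  calc (T.card : ℝ) * (1 / 2) ^ (s + 1) ≤ 2 ^ s * (1 / 2) ^ (s + 1) :=
        mul_le_mul_of_nonneg_right hTc (by positivity)
    _ = 1 / 2 := by rw [pow_succ, ← mul_assoc, ← mul_pow]; norm_num

open Finset in
/-- Shrinking the edges of a hypergraph without short Berge cycles. -/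
theorem exists_uniform_not_hasBerge {W : Type*} {ℓ s r : ℕ} (hℓ : 2 ≤ ℓ) (hs : 2 ≤ s)
    (hsr : s ≤ r) {J : Finset (Finset W)} (hJr : IsUniform r J)
    (hJ : ∀ d, 2 ≤ d → d ≤ ℓ → ¬ HasBerge J d) :
    ∃ J' : Finset (Finset W), IsUniform s J' ∧ (∀ d, 2 ≤ d → d ≤ ℓ → ¬ HasBerge J' d) ∧
      J'.card = J.card := by
  classical
  have hex : ∀ g : Finset W, ∃ h : Finset W, g ∈ J → h ⊆ g ∧ h.card = s := by
    intro g
    by_cases hg : g ∈ J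
    · obtain ⟨h, h1, h2⟩ := exists_subset_card_eq (hsr.trans (hJr g hg).ge)
      exact ⟨h, fun _ => ⟨h1, h2⟩⟩
    · exact ⟨∅, fun h => absurd h hg⟩
  choose σ hσ using hex
  refine ⟨J.image σ, ?_, ?_, ?_⟩
  · intro h hh
    obtain ⟨g, hg, rfl⟩ := mem_image.1 hh
    exact (hσ g hg).2
  · rintro d hd hdl ⟨v, e, hv, he, hc, h⟩
    have hg : ∀ i, ∃ g, i < d → g ∈ J ∧ σ g = e i := by
      intro i
      by_cases hi : i < d
      · obtain ⟨g, hg, hge⟩ := mem_image.1 (h i hi).1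
        exact ⟨g, fun _ => ⟨hg, hge⟩⟩
      · exact ⟨∅, fun h => absurd h hi⟩
    choose g hg using hg
    refine hJ d hd hdl ⟨v, g, hv, fun i hi j hj hij => he hi hj ?_, hc, fun i hi => ?_⟩
    · rw [← (hg i hi).2, ← (hg j hj).2, hij]
    · obtain ⟨h1, h2⟩ := hg i hi
      obtain ⟨-, h3, h4⟩ := h i hi
      rw [← h2] at h3 h4
      exact ⟨h1, (hσ _ h1).1 h3, (hσ _ h1).1 h4⟩
  -- Two edges shrinking to the same set share at least s ≥ 2 vertices, which would be a Berge
  -- 2-cycle.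
  · refine card_image_of_injOn fun g hg g' hg' hgg => ?_
    by_contra hne
    obtain ⟨x, hx, y, hy, hxy⟩ := one_lt_card.1 (show 1 < (σ g).card by
      rw [(hσ g hg).2]; omega)
    refine hJ 2 le_rfl hℓ (hasBerge_two hg hg' hne hxy ((hσ g hg).1 hx) ((hσ g' hg').1 ?_)
      ((hσ g hg).1 hy) ((hσ g' hg').1 ?_))
    · exact hgg ▸ hx
    · exact hgg ▸ hy

open Finset in
theorem exists_isFree_card_eq_relEx {V : Type*} (H : Finset (Finset V))
    (𝓕 : Finset (Finset V) → Prop) (h𝓕 : IsFree 𝓕 ∅) :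
    ∃ G ⊆ H, IsFree 𝓕 G ∧ G.card = relEx H 𝓕 := by
  classical
  obtain ⟨G, hG, hGc⟩ := exists_mem_eq_sup (H.powerset.filter fun G => IsFree 𝓕 G)
    ⟨∅, by simp [h𝓕]⟩ card
  rw [mem_filter, mem_powerset] at hG
  refine ⟨G, hG.1, hG.2, ?_⟩
  rw [← hGc, relEx]

open Finset in
theorem IsFree.card_le_relEx {V : Type*} {H G : Finset (Finset V)}
    {𝓕 : Finset (Finset V) → Prop} (hG : IsFree 𝓕 G) (hGH : G ⊆ H) : G.card ≤ relEx H 𝓕 := by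
  classical
  exact le_sup (f := card) (mem_filter.2 ⟨mem_powerset.2 hGH, hG⟩)

theorem isFree_empty_isShortBergeCycle {V : Type*} (r ℓ : ℕ) :
    IsFree (IsShortBergeCycle (V := V) r ℓ) ∅ := by
  rintro F hF ⟨k, hk, -, hB⟩
  obtain ⟨v, e, -, -, -, h, -⟩ := exists_seq_of_isBergeCycle hk hB
  exact absurd (hF (h 0 (by omega)).1) (Finset.notMem_empty _)

theorem isUniform_complete (V : Type*) [Fintype V] (r : ℕ) : IsUniform r (complete V r) :=
  fun _ he => (Finset.mem_powersetCard.1 he).2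

/-- The relative bound when all codegrees are at most those of a clique. -/
theorem exists_bound_of_codegree_le {ℓ r s : ℕ} (hℓ : 2 ≤ ℓ) (hs : 2 ≤ s) (hsr : s ≤ r)
    (hgirth : GirthConjecture ℓ r) {ε : ℝ} (hε : 0 < ε) :
    ∃ c : ℝ, 0 < c ∧ ∀ (V : Type*) [Fintype V] [DecidableEq V] (H : Finset (Finset V)) (Δ : ℕ),
      1 ≤ Δ → IsUniform s H →
      (∀ e ∈ H, ∀ I ⊆ e, 1 ≤ I.card → I.card < s →
        (codegree H I : ℝ) ≤ ((Δ : ℝ) ^ (1 / ((s : ℝ) - 1))) ^ (s - I.card)) →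
      ∃ G ⊆ H, SunflowerClosed ℓ G ∧
        c * (Δ : ℝ) ^ (-1 + 1 / (((s : ℝ) - 1) * ((ℓ / 2 : ℕ) : ℝ)) - ε) * (H.card : ℝ) ≤
          G.card := by
  have hs2 : (2 : ℝ) ≤ s := by exact_mod_cast hs
  have hk : (1 : ℝ) ≤ ((ℓ / 2 : ℕ) : ℝ) := by
    exact_mod_cast (Nat.le_div_iff_mul_le (by norm_num)).2 (by omega)
  set k : ℝ := ((ℓ / 2 : ℕ) : ℝ) with hkdef
  -- A loss of (s - 1) ε in the exponent of t ≈ Δ^(1/(s-1)) is a loss of ε in the exponent of Δ.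
  obtain ⟨n₀, hn₀⟩ := hgirth (((s : ℝ) - 1) * ε) (mul_pos (by linarith) hε)
  -- The density |J| / t^s is at least t^a. As a ≤ 0, an upper bound t ≤ B τ is what is needed.
  set a : ℝ := 1 + 1 / k - ((s : ℝ) - 1) * ε - s with ha
  have ha0 : a ≤ 0 := by
    have h1 : 1 / k ≤ 1 := by rw [div_le_one (by linarith)]; exact hk
    have h2 : 0 < ((s : ℝ) - 1) * ε := mul_pos (by linarith) hε
    rw [ha]; linarith
  set B : ℝ := n₀ + 2 ^ (s + 1) * s + 1 with hB
  have hB0 : 0 < B := by positivity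
  refine ⟨B ^ a / 2, by positivity, ?_⟩
  intro V _ _ H Δ hΔ hH hcod
  have hΔr : (1 : ℝ) ≤ Δ := by exact_mod_cast hΔ
  set τ : ℝ := (Δ : ℝ) ^ (1 / ((s : ℝ) - 1)) with hτ
  have hτ1 : 1 ≤ τ := Real.one_le_rpow hΔr (by
    apply div_nonneg zero_le_one; linarith)
  -- Large enough both for the girth hypothesis and for the collision bound.
  set t : ℕ := n₀ + ⌈2 ^ (s + 1) * s * τ⌉₊ with ht
  have htτ : 2 ^ (s + 1) * s * τ ≤ t := by
    rw [ht]; push_cast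
    have := Nat.le_ceil (2 ^ (s + 1) * s * τ)
    have : (0 : ℝ) ≤ n₀ := by positivity
    linarith
  have htr : (0 : ℝ) < t := lt_of_lt_of_le (by positivity) htτ
  have htB : (t : ℝ) ≤ B * τ := by
    rw [ht, hB]; push_cast
    have h1 := Nat.ceil_lt_add_one (show 0 ≤ 2 ^ (s + 1) * s * τ by positivity)
    have h2 : (n₀ : ℝ) ≤ n₀ * τ := le_mul_of_one_le_right (by positivity) hτ1
    linarith
  have ht0 : 0 < t := by exact_mod_cast htr
  obtain ⟨J₀, hJ₀, hfree, hcard⟩ := exists_isFree_card_eq_relEx (complete (Fin t) r)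
    (IsShortBergeCycle r ℓ) (isFree_empty_isShortBergeCycle r ℓ)
  have hJ₀u : IsUniform r J₀ := fun e he => isUniform_complete _ r e (hJ₀ he)
  obtain ⟨J, hJs, hJ, hJc⟩ := exists_uniform_not_hasBerge hℓ hs hsr hJ₀u
    fun d hd hdl => not_hasBerge_of_isFree hfree hJ₀u hd hdl
  have hJcard : (t : ℝ) ^ (1 + 1 / k - ((s : ℝ) - 1) * ε) ≤ J.card := by
    rw [hJc, hcard]
    exact hn₀ t (Nat.le_add_right _ _)
  obtain ⟨G, hGH, hG, hGc⟩ := exists_sunflowerClosed_of_map ht0 hJs hJ hH fun e he =>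
    sum_pow_card_sdiff_le (by linarith) ht0 htτ hH he (hcod e he)
  refine ⟨G, hGH, hG, ?_⟩
  have hts : (0 : ℝ) < (t : ℝ) ^ s := by positivity
  have h1 : (t : ℝ) ^ a * t ^ s ≤ J.card := by
    rw [← Real.rpow_natCast, ← Real.rpow_add htr]
    simpa [ha] using hJcard
  have h2 : (B * τ) ^ a ≤ (t : ℝ) ^ a := Real.rpow_le_rpow_of_nonpos htr htB ha0
  have h3 : (B * τ) ^ a = B ^ a * (Δ : ℝ) ^ (-1 + 1 / (((s : ℝ) - 1) * k) - ε) := by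
    rw [Real.mul_rpow hB0.le (by linarith), hτ, ← Real.rpow_mul (by linarith)]
    congr 2
    have : (s : ℝ) - 1 ≠ 0 := by linarith
    rw [ha]
    field_simp
    ring
  rw [h3] at h2
  have h4 : (B ^ a * (Δ : ℝ) ^ (-1 + 1 / (((s : ℝ) - 1) * k) - ε)) * H.card * t ^ s ≤
      2 * G.card * t ^ s := by
    calc _ ≤ (t : ℝ) ^ a * H.card * t ^ s := by gcongr
      _ = H.card * ((t : ℝ) ^ a * t ^ s) := by ring
      _ ≤ H.card * J.card := by gcongr
      _ ≤ _ := hGc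
      _ = _ := by ring
  have h5 := le_of_mul_le_mul_right h4 hts
  linarith

/-! ### Large codegrees: isolating and contracting marked sets -/

open Finset in
theorem codegree_le_degree {V : Type*} [DecidableEq V] (H : Finset (Finset V)) {I : Finset V}
    {v : V} (hv : v ∈ I) : codegree H I ≤ degree H v :=
  card_le_card fun e he => by
    obtain ⟨h1, h2⟩ := mem_filter.1 he
    exact mem_filter.2 ⟨h1, h2 hv⟩

open Finset in
theorem codegree_mono {V : Type*} [DecidableEq V] {H H' : Finset (Finset V)} (h : H ⊆ H')
    (I : Finset V) : codegree H I ≤ codegree H' I :=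
  card_le_card (filter_subset_filter _ h)

open Finset in
theorem card_filter_not_disjoint_le {V : Type*} [DecidableEq V] (X : Finset (Finset V))
    (e : Finset V) : (X.filter fun x => ¬ Disjoint x e).card ≤ ∑ v ∈ e, degree X v := by
  refine le_trans (card_le_card (t := e.biUnion fun v => X.filter fun x => v ∈ x) ?_)
    card_biUnion_le
  intro x hx
  obtain ⟨hx, hd⟩ := mem_filter.1 hx
  obtain ⟨v, hvx, hve⟩ := not_disjoint_iff.1 hd
  exact mem_biUnion.2 ⟨v, hve, mem_filter.2 ⟨hx, hvx⟩⟩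

open Finset in
/-- Sets of codegree at least `D` form a hypergraph of small maximum degree. -/
theorem degree_mul_le_of_le_codegree {V : Type*} [DecidableEq V] {H X : Finset (Finset V)}
    {s D : ℕ} (hH : IsUniform s H) (hX : ∀ x ∈ X, D ≤ codegree H x) (v : V) :
    degree X v * D ≤ degree H v * 2 ^ s := by
  refine card_mul_le_card_mul (fun x e : Finset V => x ⊆ e) ?_ ?_
  · intro x hx
    obtain ⟨hx, hv⟩ := mem_filter.1 hx
    refine (hX x hx).trans (card_le_card fun e he => ?_)
    obtain ⟨h1, h2⟩ := mem_filter.1 he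
    exact mem_filter.2 ⟨mem_filter.2 ⟨h1, h2 hv⟩, h2⟩
  · intro e he
    rw [← hH e (mem_filter.1 he).1, ← card_powerset]
    exact card_le_card fun x hx => mem_powerset.2 (mem_filter.1 hx).2

open Finset in
/-- A selection of edges `e` with marked subsets `I e`, such that distinct marked subsets are
disjoint from the other edges and all degrees are of the order of the codegree of the marked
subsets. -/
theorem exists_isolated_marked {V : Type*} [Fintype V] [DecidableEq V] {s D Δ M : ℕ}
    {H H₁ : Finset (Finset V)} (hH : IsUniform s H) (hsub : H₁ ⊆ H)
    (hdeg : ∀ v, degree H v ≤ Δ) (hD : 0 < D) (hM : 0 < M) (I : Finset V → Finset V)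
    (hID : ∀ e ∈ H₁, D ≤ codegree H (I e)) (hIs : ∀ e ∈ H₁, I e ⊆ e)
    (hID2 : ∀ e ∈ H₁, codegree H (I e) ≤ 2 * D) (hMD : 2 * (s * Δ * 2 ^ s + s * Δ) ≤ M * D) :
    ∃ G ⊆ H₁, H₁.card ≤ 2 * M * G.card ∧ (∀ v, degree G v ≤ 3 * D) ∧
      ∀ e ∈ G, ∀ e' ∈ G, I e ≠ I e' → Disjoint (I e') e := by
  classical
  have hDr : (0 : ℝ) < D := by exact_mod_cast hD
  let meet : Finset V → Finset V → Finset (Finset V) := fun e x =>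
    (H₁.filter fun e' => ¬ Disjoint e' e).filter fun e' => I e' = x
  -- The first term charges 1 for a marked set meeting e, the second 1 / D for each edge marked x
  -- that meets e. Load below 1 thus forbids other selected marked sets from meeting e, and allows
  -- fewer than D edges with other selected marks to meet e.
  let w : Finset V → Finset V → ℝ := fun e x =>
    (if x ∈ (H₁.image I).filter (fun x => ¬ Disjoint x e) then 1 else 0) + (meet e x).card / D
  have hw : ∀ e x, 0 ≤ w e x := fun e x => by
    simp only [w]
    positivity
  obtain ⟨T, hT⟩ := exists_selection H₁ I w hw hM (fun e he => by
    have hes : e.card = s := hH e (hsub he)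
    have h1 : ∑ x, w e x = ((H₁.image I).filter fun x => ¬ Disjoint x e).card +
        (H₁.filter fun e' => ¬ Disjoint e' e).card / (D : ℝ) := by
      simp only [w]
      rw [sum_add_distrib, ← sum_div]
      congr 1
      · rw [sum_ite_mem, univ_inter, sum_const, nsmul_eq_mul, mul_one]
      · congr 1
        exact_mod_cast (card_eq_sum_card_fiberwise (f := I) (t := univ)
          (s := H₁.filter fun e' => ¬ Disjoint e' e) fun _ _ => mem_coe.2 (mem_univ _)).symm
    have h2 : ((H₁.image I).filter fun x => ¬ Disjoint x e).card * D ≤ s * Δ * 2 ^ s := by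
      refine (Nat.mul_le_mul_right _ (card_filter_not_disjoint_le _ e)).trans ?_
      rw [sum_mul, mul_assoc, ← hes, ← smul_eq_mul, ← sum_const, hes]
      refine sum_le_sum fun v _ => ?_
      refine (degree_mul_le_of_le_codegree hH (fun x hx => ?_) v).trans
        (Nat.mul_le_mul_right _ (hdeg v))
      obtain ⟨e', he', rfl⟩ := mem_image.1 hx
      exact hID e' he'
    have h3 : (H₁.filter fun e' => ¬ Disjoint e' e).card ≤ s * Δ := by
      refine (card_filter_not_disjoint_le _ e).trans ?_
      rw [← hes, ← smul_eq_mul, ← sum_const]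
      exact sum_le_sum fun v _ => le_trans (card_le_card (filter_subset_filter _ hsub)) (hdeg v)
    rw [h1, ← mul_le_mul_iff_left₀ hDr]
    have h4 : ((2 * (s * Δ * 2 ^ s + s * Δ) : ℕ) : ℝ) ≤ (M * D : ℕ) := Nat.cast_le.2 hMD
    have h5 : ((((H₁.image I).filter fun x => ¬ Disjoint x e).card * D : ℕ) : ℝ) ≤
        (s * Δ * 2 ^ s : ℕ) := Nat.cast_le.2 h2
    have h6 : ((H₁.filter fun e' => ¬ Disjoint e' e).card : ℝ) ≤ (s * Δ : ℕ) := Nat.cast_le.2 h3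
    push_cast at h4 h5 h6
    have h7 : (H₁.filter fun e' => ¬ Disjoint e' e).card / (D : ℝ) * D =
        (H₁.filter fun e' => ¬ Disjoint e' e).card := div_mul_cancel₀ _ hDr.ne'
    calc _ = 2 * (((H₁.image I).filter fun x => ¬ Disjoint x e).card * (D : ℝ) +
          (H₁.filter fun e' => ¬ Disjoint e' e).card / (D : ℝ) * D) := by ring
      _ ≤ _ := by rw [h7]; linarith)
  set G := H₁.filter fun e => I e ∈ T ∧ ∑ x ∈ T.erase (I e), w e x < 1 with hG
  refine ⟨G, filter_subset _ _, hT, fun v => ?_, fun e he e' he' hne => ?_⟩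
  · rcases (G.filter fun e => v ∈ e).eq_empty_or_nonempty with h0 | ⟨e, he⟩
    · simp [degree, h0]
    obtain ⟨heG, hve⟩ := mem_filter.1 he
    obtain ⟨heH, heT, hsum⟩ := mem_filter.1 heG
    -- Fix one selected edge e at v. Any selected edge at v either contains I e (at most 2D edges)
    -- or meets e while carrying another selected mark (fewer than D).
    have hcover : (G.filter fun e' => v ∈ e') ⊆
        (H.filter fun e' => I e ⊆ e') ∪ (T.erase (I e)).biUnion (meet e) := by
      intro e' he'
      obtain ⟨he'G, hve'⟩ := mem_filter.1 he'
      obtain ⟨he'H, he'T, -⟩ := mem_filter.1 he'G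
      by_cases hI : I e' = I e
      · exact mem_union_left _ (mem_filter.2 ⟨hsub he'H, hI ▸ hIs e' he'H⟩)
      · refine mem_union_right _ (mem_biUnion.2 ⟨I e', mem_erase.2 ⟨hI, he'T⟩, ?_⟩)
        exact mem_filter.2 ⟨mem_filter.2 ⟨he'H, not_disjoint_iff.2 ⟨v, hve', hve⟩⟩, rfl⟩
    have h1 : ((∑ x ∈ T.erase (I e), (meet e x).card : ℕ) : ℝ) < D := by
      have h2 : ∑ x ∈ T.erase (I e), ((meet e x).card : ℝ) / D < 1 := by
        refine lt_of_le_of_lt (sum_le_sum fun x _ => ?_) hsum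
        simp only [w]
        exact le_add_of_nonneg_left (by positivity)
      rw [← sum_div, div_lt_one hDr] at h2
      exact_mod_cast h2
    have h2 : ∑ x ∈ T.erase (I e), (meet e x).card < D := by exact_mod_cast h1
    have h3 := (card_le_card hcover).trans ((card_union_le _ _).trans
      (Nat.add_le_add (hID2 e heH) card_biUnion_le))
    simp only [degree]
    omega
  · obtain ⟨heH, heT, hsum⟩ := mem_filter.1 he
    obtain ⟨he'H, he'T, -⟩ := mem_filter.1 he'
    by_contra hd
    have h1 := single_le_sum (f := w e) (fun x _ => hw e x) (mem_erase.2 ⟨hne.symm, he'T⟩)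
    have h2 : 1 ≤ w e (I e') := by
      simp only [w]
      rw [if_pos (mem_filter.2 ⟨mem_image_of_mem _ he'H, hd⟩)]
      exact le_add_of_nonneg_right (by positivity)
    linarith

open Finset in
/-- Contracting isolated marked subsets to single vertices. -/
theorem exists_contraction {V : Type*} [DecidableEq V] {s i : ℕ} {G : Finset (Finset V)}
    (hG : IsUniform s G) (I : Finset V → Finset V) (hi : 0 < i)
    (hIs : ∀ e ∈ G, I e ⊆ e) (hIc : ∀ e ∈ G, (I e).card = i)
    (hdisj : ∀ e ∈ G, ∀ e' ∈ G, I e ≠ I e' → Disjoint (I e') e) :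
    ∃ π : V → V, (∀ e ∈ G, ∀ x, π x ∈ e.image π → x ∈ e) ∧
      IsUniform (s - i + 1) (G.image (Finset.image π)) ∧
      (∀ v, degree (G.image (Finset.image π)) v ≤ degree G v) ∧
      (G.image (Finset.image π)).card = G.card := by
  classical
  have hrep : ∀ S : Finset V, ∀ x : V, ∃ y, S.Nonempty → y ∈ S := fun S x => by
    rcases S.eq_empty_or_nonempty with h | ⟨y, hy⟩
    · exact ⟨x, fun h' => absurd h h'.ne_empty⟩
    · exact ⟨y, fun _ => hy⟩
  rcases isEmpty_or_nonempty V with hV | ⟨⟨x₀⟩⟩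
  · have : G = ∅ := by
      refine eq_empty_of_forall_notMem fun e he => ?_
      have h1 := card_le_card (hIs e he)
      rw [hIc e he, eq_empty_of_isEmpty e, card_empty] at h1
      omega
    subst this
    exact ⟨id, by simp, by simp [IsUniform], by simp [degree], by simp⟩
  choose rep hrep using fun S => hrep S x₀
  -- Consistent because distinct marked sets are disjoint, so the choice of the edge whose mark
  -- contains x is immaterial.
  let π : V → V := fun x => if h : ∃ e ∈ G, x ∈ I e then rep (I h.choose) else x
  have hIne : ∀ e ∈ G, (I e).Nonempty := fun e he => card_pos.1 (by rw [hIc e he]; exact hi)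
  have hsame : ∀ e ∈ G, ∀ e' ∈ G, ∀ x, x ∈ e → x ∈ I e' → I e = I e' := fun e he e' he' x hx hx' =>
    by_contra fun hne => disjoint_left.1 (hdisj e he e' he' hne) hx' hx
  have ha : ∀ e ∈ G, ∀ x ∈ I e, π x = rep (I e) := by
    intro e he x hx
    have h : ∃ e ∈ G, x ∈ I e := ⟨e, he, hx⟩
    simp only [π, dif_pos h]
    congr 1
    exact (hsame e he _ h.choose_spec.1 x (hIs e he hx) h.choose_spec.2).symm
  have hb : ∀ e ∈ G, ∀ x ∈ e, x ∉ I e → π x = x := by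
    intro e he x hx hxI
    have h : ¬ ∃ e ∈ G, x ∈ I e := by
      rintro ⟨e', he', hx'⟩
      exact hxI (hsame e he e' he' x hx hx' ▸ hx')
    simp only [π, dif_neg h]
  have hr : ∀ e ∈ G, rep (I e) ∈ I e := fun e he => hrep _ (hIne e he)
  have himg : ∀ e ∈ G, e.image π = insert (rep (I e)) (e \ I e) := by
    intro e he
    ext y
    simp only [mem_image, mem_insert, mem_sdiff]
    constructor
    · rintro ⟨x, hx, rfl⟩
      by_cases hxI : x ∈ I e
      · exact Or.inl (ha e he x hxI)
      · rw [hb e he x hx hxI]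
        exact Or.inr ⟨hx, hxI⟩
    · rintro (rfl | ⟨hy, hyI⟩)
      · exact ⟨_, hIs e he (hr e he), ha e he _ (hr e he)⟩
      · exact ⟨y, hy, hb e he y hy hyI⟩
  have hsubs : ∀ e ∈ G, e.image π ⊆ e := by
    intro e he
    rw [himg e he]
    exact insert_subset (hIs e he (hr e he)) sdiff_subset
  -- If the representative of a marked set lies in e, that set is the mark of e itself and so lies
  -- entirely in e.
  have hd : ∀ e ∈ G, ∀ x, π x ∈ e.image π → x ∈ e := by
    intro e he x hx
    have hxe := hsubs e he hx
    by_cases h : ∃ e ∈ G, x ∈ I e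
    · obtain ⟨e', he', hx'⟩ := h
      rw [ha e' he' x hx'] at hxe
      have := hsame e he e' he' _ hxe (hr e' he')
      exact hIs e he (this ▸ hx')
    · simpa only [π, dif_neg h] using hxe
  refine ⟨π, hd, ?_, ?_, ?_⟩
  · intro f hf
    obtain ⟨e, he, rfl⟩ := mem_image.1 hf
    rw [himg e he, card_insert_of_notMem (fun h => (mem_sdiff.1 h).2 (hr e he)),
      card_sdiff_of_subset (hIs e he), hG e he, hIc e he]
  · intro v
    refine le_trans (card_le_card (t := (G.filter fun e => v ∈ e).image (Finset.image π)) ?_)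
      card_image_le
    intro f hf
    obtain ⟨hf, hv⟩ := mem_filter.1 hf
    obtain ⟨e, he, rfl⟩ := mem_image.1 hf
    exact mem_image_of_mem _ (mem_filter.2 ⟨he, hsubs e he hv⟩)
  · refine card_image_of_injOn fun e he e' he' hee => ?_
    ext x
    exact ⟨fun hx => hd e' he' x (hee ▸ mem_image_of_mem _ hx),
      fun hx => hd e he x (hee ▸ mem_image_of_mem _ hx)⟩

/-! ### Induction on the uniformity -/

open Finset in
theorem exists_card_le_mul_card_fiber {α β : Type*} [DecidableEq β] (S : Finset α) (T : Finset β)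
    (hT : T.Nonempty) (f : α → β) (hf : ∀ a ∈ S, f a ∈ T) :
    ∃ b ∈ T, S.card ≤ T.card * (S.filter fun a => f a = b).card := by
  by_contra! hcon
  have h1 := card_eq_sum_card_fiberwise (f := f) (s := S) (t := T) hf
  have h2 := sum_lt_sum_of_nonempty hT hcon
  rw [← mul_sum, ← h1, sum_const, smul_eq_mul] at h2
  exact lt_irrefl _ h2

/-- Bounds the number of dyadic codegree classes, so that pigeonholing over them costs only an
arbitrarily small power of Δ. -/
theorem natLog_add_one_le {ε : ℝ} (hε : 0 < ε) {Δ : ℕ} (hΔ : 1 ≤ Δ) :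
    (Nat.log 2 Δ : ℝ) + 1 ≤ (2 / ε + 1) * (Δ : ℝ) ^ ε := by
  have hΔr : (1 : ℝ) ≤ Δ := by exact_mod_cast hΔ
  have h1 : (Nat.log 2 Δ : ℝ) ≤ Real.logb 2 Δ := by
    exact_mod_cast Real.natLog_le_logb Δ 2
  have h2 : Real.logb 2 Δ ≤ 2 * Real.log Δ := by
    have h3 := Real.log_two_gt_d9
    have h4 := Real.log_nonneg hΔr
    rw [Real.logb, div_le_iff₀ (by linarith)]
    nlinarith
  have h3 := Real.log_le_rpow_div (x := (Δ : ℝ)) (by linarith) hε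
  have h4 : 1 ≤ (Δ : ℝ) ^ ε := Real.one_le_rpow hΔr hε.le
  calc (Nat.log 2 Δ : ℝ) + 1 ≤ 2 * ((Δ : ℝ) ^ ε / ε) + (Δ : ℝ) ^ ε := by linarith
    _ = _ := by ring

theorem exists_pos_le_of_lt (n : ℕ) (c : ℕ → ℝ) (hc : ∀ i < n, 0 < c i) :
    ∃ c₀ : ℝ, 0 < c₀ ∧ ∀ i < n, c₀ ≤ c i := by
  induction n with
  | zero => exact ⟨1, one_pos, fun i hi => absurd hi (Nat.not_lt_zero i)⟩
  | succ n ih =>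
    obtain ⟨c₀, h0, h⟩ := ih fun i hi => hc i (by omega)
    refine ⟨min c₀ (c n), lt_min h0 (hc n (by omega)), fun i hi => ?_⟩
    rcases Nat.lt_succ_iff_lt_or_eq.1 hi with h1 | rfl
    · exact (min_le_left _ _).trans (h i h1)
    · exact min_le_right _ _

theorem sunflowerClosed_empty {V : Type*} [DecidableEq V] (ℓ : ℕ) :
    SunflowerClosed ℓ (∅ : Finset (Finset V)) := by
  intro k v e hk _ _ _ h
  exact absurd (h 0 (by omega)).1 (Finset.notMem_empty _)

/-- Final bookkeeping for large codegrees: h and h' stand for the edge counts before and after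
pigeonholing, q p for the loss there, y for (3D)^β, and g for the edges found. -/
theorem div_mul_mul_le {c c' S q Δ x p y h h' g : ℝ} (hc : 0 ≤ c) (hS : 0 < S) (hq : 0 < q)
    (hΔ : 0 < Δ) (hx : 0 ≤ x) (hp : 0 ≤ p) (hh' : 0 ≤ h') (hh : h ≤ q * p * h') (hy : x * p * Δ ≤ y)
    (hcc : c ≤ c') (hg : c' * (y / 3) * h' ≤ S * Δ * g) :
    c / (3 * S * q) * x * h ≤ g := by
  refine le_of_mul_le_mul_right ?_ (show 0 < S * Δ by positivity)
  calc c / (3 * S * q) * x * h * (S * Δ) ≤ c / (3 * S * q) * x * (q * p * h') * (S * Δ) := by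
        gcongr
    _ = c * (x * p * Δ / 3) * h' := by field_simp
    _ ≤ c' * (y / 3) * h' := by
        have := hc.trans hcc
        gcongr
    _ ≤ S * Δ * g := hg
    _ = _ := by ring

/-- The relative bound with constant `c` and loss `ε` in the exponent. -/
def RelativeBound.{u} (ℓ s : ℕ) (ε c : ℝ) : Prop :=
  ∀ (V : Type u) [Fintype V] [DecidableEq V] (H : Finset (Finset V)) (Δ : ℕ),
    1 ≤ Δ → IsUniform s H → (∀ v, degree H v ≤ Δ) →
    ∃ G ⊆ H, SunflowerClosed ℓ G ∧
      c * (Δ : ℝ) ^ (-1 + 1 / (((s : ℝ) - 1) * ((ℓ / 2 : ℕ) : ℝ)) - ε) * (H.card : ℝ) ≤ G.card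

open Finset in
/-- The relative bound for edges with marked subsets of size `i` and codegree about `D`, from the
relative bound for the contracted hypergraph. -/
theorem RelativeBound.exists_of_marked.{u} {ℓ s i : ℕ} {ε c : ℝ} (hc : 0 < c)
    (hi : 2 ≤ i) (his : i < s) (hb : RelativeBound.{u} ℓ (s - i + 1) ε c) {V : Type u} [Fintype V]
    [DecidableEq V] {H H₁ : Finset (Finset V)} {D Δ : ℕ} (hH : IsUniform s H) (hsub : H₁ ⊆ H)
    (hdeg : ∀ v, degree H v ≤ Δ) (hD : 0 < D) (hDΔ : D ≤ Δ) (I : Finset V → Finset V)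
    (hIs : ∀ e ∈ H₁, I e ⊆ e) (hIc : ∀ e ∈ H₁, (I e).card = i)
    (hID : ∀ e ∈ H₁, D ≤ codegree H (I e)) (hID2 : ∀ e ∈ H₁, codegree H (I e) ≤ 2 * D) :
    ∃ G ⊆ H₁, SunflowerClosed ℓ G ∧
      c * ((3 * D : ℕ) : ℝ) ^ (-1 + 1 / (((s : ℝ) - i) * ((ℓ / 2 : ℕ) : ℝ)) - ε) *
        (D * H₁.card) ≤ s * 2 ^ (s + 4) * Δ * G.card := by
  classical
  set Q : ℕ := 2 * (s * Δ * 2 ^ s + s * Δ) with hQ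
  -- Large enough for the load condition, while D ≤ Δ keeps M D of order Δ, so that sampling costs
  -- only a factor of order Δ / D.
  set M : ℕ := Q / D + 1 with hM
  have hMD : Q ≤ M * D := by
    rw [hM]
    exact (Nat.lt_mul_of_div_lt (Nat.lt_succ_self (Q / D)) hD).le.trans (by rw [Nat.succ_eq_add_one])
  have hMD' : M * D ≤ s * 2 ^ (s + 3) * Δ := by
    have h1 : M * D ≤ Q + D := by
      rw [hM, add_mul, one_mul]
      exact Nat.add_le_add_right (Nat.div_mul_le_self _ _) _
    have h2 : 1 ≤ 2 ^ s := Nat.one_le_two_pow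
    have h3 : D ≤ s * Δ := hDΔ.trans (Nat.le_mul_of_pos_left _ (by omega))
    have h4 : s * Δ ≤ s * Δ * 2 ^ s := Nat.le_mul_of_pos_right _ (by positivity)
    calc M * D ≤ Q + D := h1
      _ ≤ 8 * (s * Δ * 2 ^ s) := by rw [hQ]; omega
      _ = _ := by rw [pow_add]; ring
  obtain ⟨G, hGH, hGc, hGd, hdisj⟩ := exists_isolated_marked hH hsub hdeg hD (Nat.succ_pos (Q / D))
    I hID hIs hID2 hMD
  obtain ⟨π, hπ, hu, hd, hcard⟩ := exists_contraction (s := s) (i := i)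
    (fun e he => hH e (hsub (hGH he))) I (by omega) (fun e he => hIs e (hGH he))
    (fun e he => hIc e (hGH he)) hdisj
  obtain ⟨F, hF, hFs, hFc⟩ := hb V _ (3 * D) (by omega) hu fun v => (hd v).trans (hGd v)
  have himg : (G.filter fun e => e.image π ∈ F).image (Finset.image π) = F := by
    ext f
    simp only [mem_image, mem_filter]
    constructor
    · rintro ⟨e, ⟨-, h⟩, rfl⟩
      exact h
    · intro hf
      obtain ⟨e, he, rfl⟩ := mem_image.1 (hF hf)
      exact ⟨e, ⟨he, hf⟩, rfl⟩
  refine ⟨G.filter fun e => e.image π ∈ F, (filter_subset _ _).trans hGH,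
    SunflowerClosed.of_image π (fun e he => hπ e (mem_filter.1 he).1) (himg.symm ▸ hFs), ?_⟩
  have hle : F.card ≤ (G.filter fun e => e.image π ∈ F).card := by
    conv_lhs => rw [← himg]
    exact card_image_le
  have hcast : (((s - i + 1 : ℕ) : ℝ) - 1) = s - i := by
    push_cast [his.le]
    ring
  rw [hcard, hcast] at hFc
  have h1 : D * H₁.card ≤ s * 2 ^ (s + 4) * Δ * G.card :=
    calc D * H₁.card ≤ D * (2 * M * G.card) := Nat.mul_le_mul_left _ hGc
      _ = 2 * (M * D) * G.card := by ring
      _ ≤ 2 * (s * 2 ^ (s + 3) * Δ) * G.card := by gcongr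
      _ = _ := by rw [pow_succ _ (s + 3)]; ring
  have h2 : (D : ℝ) * H₁.card ≤ s * 2 ^ (s + 4) * Δ * G.card := by exact_mod_cast h1
  have h3 : (F.card : ℝ) ≤ (G.filter fun e => e.image π ∈ F).card := Nat.cast_le.2 hle
  set x : ℝ := c * ((3 * D : ℕ) : ℝ) ^ (-1 + 1 / (((s : ℝ) - i) * ((ℓ / 2 : ℕ) : ℝ)) - ε) with hx
  have hx0 : 0 ≤ x := by positivity
  calc x * (D * H₁.card) ≤ x * (s * 2 ^ (s + 4) * Δ * G.card) := by gcongr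
    _ = s * 2 ^ (s + 4) * Δ * (x * G.card) := by ring
    _ ≤ s * 2 ^ (s + 4) * Δ * ((G.filter fun e => e.image π ∈ F).card) := by
      gcongr
      exact hFc.trans h3

/-- The threshold τ^(s-i) = Δ^((s-i)/(s-1)), raised to 1/((s-i)k), is Δ^(1/((s-1)k)) for every i, so
contraction loses nothing in the main exponent. The bound ε' ≤ 1/(sk) keeps the exponent of y
nonnegative, as monotonicity requires. -/
theorem rpow_le_rpow_of_root_pow_le {s i : ℕ} {k ε ε' Δ y : ℝ} (hi : 2 ≤ i) (his : i < s)
    (hk : 1 ≤ k) (hΔ : 1 ≤ Δ) (hε' : 0 < ε') (hε : ε' ≤ ε / 2) (hsk : ε' ≤ 1 / (s * k))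
    (hy : (Δ ^ (1 / ((s : ℝ) - 1))) ^ (s - i) ≤ y) :
    Δ ^ (1 / (((s : ℝ) - 1) * k) - ε / 2) ≤ y ^ (1 / (((s : ℝ) - i) * k) - ε') := by
  have hi2 : (2 : ℝ) ≤ i := by exact_mod_cast hi
  have hsi : (0 : ℝ) < s - i := sub_pos.2 (by exact_mod_cast his)
  have hs1 : (0 : ℝ) < (s : ℝ) - 1 := by linarith
  have hΔ0 : 0 ≤ Δ := by linarith
  have hk0 : 0 < k := by linarith
  have hβ0 : 0 ≤ 1 / (((s : ℝ) - i) * k) - ε' := by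
    have h1 : 1 / (s * k) ≤ 1 / (((s : ℝ) - i) * k) := by
      apply one_div_le_one_div_of_le (mul_pos hsi hk0)
      gcongr
      linarith
    linarith
  refine le_trans ?_ (Real.rpow_le_rpow (by positivity) hy hβ0)
  rw [← Real.rpow_natCast, ← Real.rpow_mul hΔ0, ← Real.rpow_mul hΔ0, Nat.cast_sub his.le]
  refine Real.rpow_le_rpow_of_exponent_le hΔ ?_
  have h1 : 1 / ((s : ℝ) - 1) * (s - i) * (1 / (((s : ℝ) - i) * k) - ε') =
      1 / (((s : ℝ) - 1) * k) - ((s - i) / ((s : ℝ) - 1)) * ε' := by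
    field_simp
  have h2 : (s - i) / ((s : ℝ) - 1) * ε' ≤ 1 * (ε / 2) := by
    refine mul_le_mul ?_ hε hε'.le zero_le_one
    rw [div_le_one hs1]
    linarith
  rw [h1]
  linarith

-- Either the edges with clique-like codegrees make up half of `H`, or a majority carries marked
-- sets of larger codegree. Marks have between 2 and s - 1 vertices, so contraction lowers the
-- uniformity but keeps it at least 2.
open Finset in
theorem exists_relativeBound.{u} {ℓ r : ℕ} (hℓ : 2 ≤ ℓ) (hgirth : GirthConjecture ℓ r) (s : ℕ) :
    2 ≤ s → s ≤ r → ∀ ε : ℝ, 0 < ε → ∃ c : ℝ, 0 < c ∧ RelativeBound.{u} ℓ s ε c := by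
  induction s using Nat.strong_induction_on with
  | _ s ih =>
  intro hs hsr ε hε
  classical
  have hs2 : (2 : ℝ) ≤ s := by exact_mod_cast hs
  have hk : (1 : ℝ) ≤ ((ℓ / 2 : ℕ) : ℝ) := by
    exact_mod_cast (Nat.le_div_iff_mul_le (by norm_num)).2 (by omega)
  set k : ℝ := ((ℓ / 2 : ℕ) : ℝ) with hkdef
  obtain ⟨c₁, hc₁, hA⟩ := exists_bound_of_codegree_le.{u} hℓ hs hsr hgirth hε
  -- Half of ε is left for the logarithmic loss in the pigeonhole step.
  set ε' : ℝ := min (ε / 2) (1 / (s * k)) with hε'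
  have hε'0 : 0 < ε' := by
    rw [hε']
    positivity
  have hIH : ∀ i, ∃ c : ℝ, 0 < c ∧ (2 ≤ i → i < s → RelativeBound.{u} ℓ (s - i + 1) ε' c) := by
    intro i
    by_cases hi : 2 ≤ i ∧ i < s
    · obtain ⟨c, hc, hb⟩ := ih (s - i + 1) (by omega) (by omega) (by omega) ε' hε'0
      exact ⟨c, hc, fun _ _ => hb⟩
    · exact ⟨1, one_pos, fun h1 h2 => absurd ⟨h1, h2⟩ hi⟩
  choose cf hcf hbf using hIH
  obtain ⟨c₂, hc₂, hc₂le⟩ := exists_pos_le_of_lt s cf fun i _ => hcf i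
  set L : ℝ := 2 / (ε / 2) + 1 with hL
  have hL0 : 0 < L := by positivity
  set C : ℝ := 3 * (s * 2 ^ (s + 4)) * (2 * s * L) with hC
  have hC0 : 0 < C := by positivity
  refine ⟨min (c₁ / 2) (c₂ / C), by positivity, ?_⟩
  intro V _ _ H Δ hΔ hH hdeg
  have hΔr : (1 : ℝ) ≤ Δ := by exact_mod_cast hΔ
  have hΔ0 : (0 : ℝ) < Δ := by linarith
  set τ : ℝ := (Δ : ℝ) ^ (1 / ((s : ℝ) - 1)) with hτ
  have hτ0 : 0 < τ := by positivity
  have hτs : τ ^ (s - 1) = Δ := by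
    rw [hτ, ← Real.rpow_natCast, ← Real.rpow_mul hΔ0.le, Nat.cast_sub (by omega), Nat.cast_one,
      one_div, inv_mul_cancel₀ (by linarith), Real.rpow_one]
  set x : ℝ := (Δ : ℝ) ^ (-1 + 1 / (((s : ℝ) - 1) * k) - ε) with hx
  have hx0 : 0 < x := by positivity
  let light : Finset V → Prop := fun e => ∀ I ⊆ e, 1 ≤ I.card → I.card < s →
    (codegree H I : ℝ) ≤ τ ^ (s - I.card)
  have hsplit : (H.filter light).card + (H.filter fun e => ¬ light e).card = H.card :=
    card_filter_add_card_filter_not (s := H) light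
  by_cases hhalf : H.card ≤ 2 * (H.filter light).card
  · obtain ⟨G, hG, hGs, hGc⟩ := hA V (H.filter light) Δ hΔ
      (fun e he => hH e (mem_filter.1 he).1) fun e he I hI h1 h2 =>
        (Nat.cast_le.2 (codegree_mono (filter_subset _ _) I)).trans ((mem_filter.1 he).2 I hI h1 h2)
    refine ⟨G, hG.trans (filter_subset _ _), hGs, le_trans ?_ hGc⟩
    have h1 : (H.card : ℝ) ≤ 2 * (H.filter light).card := by exact_mod_cast hhalf
    calc min (c₁ / 2) (c₂ / C) * x * H.card ≤ (c₁ / 2) * x * (2 * (H.filter light).card) := by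
          gcongr
          exact min_le_left _ _
      _ = _ := by ring
  set HB := H.filter fun e => ¬ light e with hHB
  have hHBc : H.card < 2 * HB.card := by omega
  have hmark : ∀ e, ∃ I : Finset V, e ∈ HB →
      I ⊆ e ∧ 2 ≤ I.card ∧ I.card < s ∧ τ ^ (s - I.card) < codegree H I := by
    intro e
    by_cases he : e ∈ HB
    · have hl := (mem_filter.1 he).2
      simp only [light, not_forall, not_le] at hl
      obtain ⟨I, hI, h1, h2, h3⟩ := hl
      refine ⟨I, fun _ => ⟨hI, ?_, h2, h3⟩⟩
      -- A singleton mark would have degree above τ^(s-1) = Δ.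
      by_contra hlt
      have hI1 : I.card = 1 := by omega
      obtain ⟨v, hv⟩ := card_pos.1 h1
      rw [hI1, hτs] at h3
      have h4 := (codegree_le_degree H hv).trans (hdeg v)
      have h5 : Δ < codegree H I := by exact_mod_cast h3
      omega
    · exact ⟨∅, fun h => absurd h he⟩
  choose I hI using hmark
  have hIΔ : ∀ e ∈ HB, codegree H (I e) ≤ Δ := by
    intro e he
    obtain ⟨v, hv⟩ := card_pos.1 (show 0 < (I e).card by have := (hI e he).2.1; omega)
    exact (codegree_le_degree H hv).trans (hdeg v)
  have hIpos : ∀ e ∈ HB, codegree H (I e) ≠ 0 := by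
    intro e he h0
    have h1 := (hI e he).2.2.2
    rw [h0, Nat.cast_zero] at h1
    exact absurd h1 (not_lt.2 (by positivity))
  -- Fix the size of the mark and the dyadic range of its codegree.
  obtain ⟨⟨i, j⟩, -, hpig⟩ := exists_card_le_mul_card_fiber HB
    (range s ×ˢ range (Nat.log 2 Δ + 1)) ⟨(0, 0), by simp; omega⟩
    (fun e => ((I e).card, Nat.log 2 (codegree H (I e)))) (fun e he => by
      rw [mem_product, mem_range, mem_range]
      exact ⟨(hI e he).2.2.1, Nat.lt_succ_of_le (Nat.log_mono_right (b := 2) (hIΔ e he))⟩)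
  rw [card_product, card_range, card_range] at hpig
  set H₁ := HB.filter fun e => ((I e).card, Nat.log 2 (codegree H (I e))) = (i, j) with hH₁
  have hH₁m : ∀ e ∈ H₁, e ∈ HB ∧ (I e).card = i ∧ Nat.log 2 (codegree H (I e)) = j := by
    intro e he
    obtain ⟨h1, h2⟩ := mem_filter.1 he
    exact ⟨h1, (Prod.mk.inj h2).1, (Prod.mk.inj h2).2⟩
  obtain ⟨e₀, he₀⟩ : H₁.Nonempty := by
    rw [← card_pos]
    by_contra h0
    rw [Nat.eq_zero_of_not_pos h0] at hpig
    omega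
  obtain ⟨he₀B, he₀i, he₀j⟩ := hH₁m e₀ he₀
  obtain ⟨-, hi2, his, hiτ⟩ := hI e₀ he₀B
  rw [he₀i] at hi2 his hiτ
  set D : ℕ := 2 ^ j with hD
  have hDle : ∀ e ∈ H₁, D ≤ codegree H (I e) := fun e he => by
    obtain ⟨h1, -, h3⟩ := hH₁m e he
    rw [hD, ← h3]
    exact Nat.pow_log_le_self 2 (hIpos e h1)
  have hD2 : ∀ e ∈ H₁, codegree H (I e) ≤ 2 * D := fun e he => by
    obtain ⟨-, -, h3⟩ := hH₁m e he
    rw [hD, ← h3, ← pow_succ']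
    exact (Nat.lt_pow_succ_log_self (by norm_num) _).le
  have hD0 : 0 < D := by positivity
  have hτD : τ ^ (s - i) ≤ ((2 * D : ℕ) : ℝ) := hiτ.le.trans (Nat.cast_le.2 (hD2 e₀ he₀))
  obtain ⟨G, hG, hGs, hGc⟩ := RelativeBound.exists_of_marked (hcf i) hi2 his (hbf i hi2 his) hH
    ((filter_subset _ _).trans (filter_subset _ _)) hdeg hD0 ((hDle e₀ he₀).trans (hIΔ e₀ he₀B)) I
    (fun e he => (hI e (hH₁m e he).1).1) (fun e he => (hH₁m e he).2.1) hDle hD2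
  refine ⟨G, hG.trans ((filter_subset _ _).trans (filter_subset _ _)), hGs, ?_⟩
  have hGc : cf i * ((3 * D : ℕ) : ℝ) ^ (-1 + 1 / (((s : ℝ) - i) * k) - ε') * (D * H₁.card) ≤
      s * 2 ^ (s + 4) * Δ * G.card := hGc
  clear_value D x H₁ HB
  clear hG hGs hI he₀ he₀B hH₁m hDle hIpos hIΔ hbf hcf ih
  set β : ℝ := 1 / (((s : ℝ) - i) * k) - ε' with hβ
  have hDr : (0 : ℝ) < D := Nat.cast_pos.2 hD0
  have hD3 : (0 : ℝ) < ((3 * D : ℕ) : ℝ) := by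
    push_cast
    positivity
  have hpow : (Δ : ℝ) ^ (1 / (((s : ℝ) - 1) * k) - ε / 2) ≤ ((3 * D : ℕ) : ℝ) ^ β :=
    rpow_le_rpow_of_root_pow_le hi2 his hk hΔr hε'0 (min_le_left _ _) (min_le_right _ _)
      (hτD.trans (Nat.cast_le.2 (by omega)))
  have hexp : ((3 * D : ℕ) : ℝ) ^ (-1 + 1 / (((s : ℝ) - i) * k) - ε') * D =
      ((3 * D : ℕ) : ℝ) ^ β / 3 := by
    rw [show -1 + 1 / (((s : ℝ) - i) * k) - ε' = β - 1 by rw [hβ]; ring, Real.rpow_sub_one hD3.ne']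
    push_cast
    field_simp
  have hHcard : (H.card : ℝ) ≤ 2 * s * L * (Δ : ℝ) ^ (ε / 2) * H₁.card := by
    have h1 : H.card ≤ 2 * (s * (Nat.log 2 Δ + 1) * H₁.card) := by omega
    have h2 : (H.card : ℝ) ≤ 2 * (s * (Nat.log 2 Δ + 1) * H₁.card) := by exact_mod_cast h1
    refine h2.trans ?_
    calc (2 : ℝ) * (s * (Nat.log 2 Δ + 1) * H₁.card)
        ≤ 2 * (s * (L * (Δ : ℝ) ^ (ε / 2)) * H₁.card) := by
          gcongr
          exact natLog_add_one_le (by positivity) hΔ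
      _ = _ := by ring
  have hxeq : x * (Δ : ℝ) ^ (ε / 2) * Δ = (Δ : ℝ) ^ (1 / (((s : ℝ) - 1) * k) - ε / 2) := by
    rw [hx, ← Real.rpow_add hΔ0, ← Real.rpow_add_one hΔ0.ne']
    congr 1
    ring
  have hGc' : cf i * (((3 * D : ℕ) : ℝ) ^ β / 3) * H₁.card ≤ s * 2 ^ (s + 4) * Δ * G.card := by
    rw [← hexp]
    exact (le_of_eq (by ring)).trans hGc
  have hfin := div_mul_mul_le (S := (s : ℝ) * 2 ^ (s + 4)) (q := 2 * s * L) hc₂.le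
    (by positivity) (by positivity) hΔ0 hx0.le (by positivity) (by positivity) hHcard
    (hxeq.trans_le hpow) (hc₂le i his) hGc'
  have hmin : min (c₁ / 2) (c₂ / C) ≤ c₂ / C := min_le_right _ _
  exact (mul_le_mul_of_nonneg_right (mul_le_mul_of_nonneg_right hmin hx0.le)
    (Nat.cast_nonneg _)).trans hfin

/-! ### Upper bound: reduction to graphs of large girth -/

/-- Otherwise the three edges form a Berge triangle on x, b, a. It must be a sunflower, so b lies in
the kernel e ∩ e₁ and hence in e₂. -/
theorem IsFree.not_triangle {V : Type*} [DecidableEq V] {ℓ r : ℕ} {G : Finset (Finset V)}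
    (hG : IsFree (IsShortNonSunflowerBergeCycle r ℓ) G) (hu : IsUniform r G) (hℓ : 3 ≤ ℓ)
    {e e₁ e₂ : Finset V} (he : e ∈ G) (he₁ : e₁ ∈ G) (he₂ : e₂ ∈ G) (hne : e ≠ e₁) {a b x : V}
    (hab : a ≠ b) (hax : a ≠ x) (hbx : b ≠ x) (ha₁ : a ∈ e₁) (ha₂ : a ∈ e₂) (hb : b ∈ e)
    (hb₁ : b ∈ e₁) (hx : x ∈ e) (hx₂ : x ∈ e₂) : b ∈ e₂ := by
  by_contra hb₂
  have h02 : e ≠ e₂ := fun h => hb₂ (h ▸ hb)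
  have h12 : e₁ ≠ e₂ := fun h => hb₂ (h ▸ hb₁)
  obtain ⟨F, hF, hB, hmem⟩ := exists_subset_isBergeCycle (k := 3) hu (by norm_num)
    (fun i => if i = 1 then b else if i = 2 then a else x)
    (fun i => if i = 0 then e else if i = 1 then e₁ else e₂)
    (fun i hi j hj hij => by
      simp only [Set.mem_Iio] at hi hj
      interval_cases i <;> interval_cases j <;> simp_all)
    (fun i hi j hj hij => by
      simp only [Set.mem_Iio] at hi hj
      interval_cases i <;> interval_cases j <;> simp_all)
    (by simp)
    (fun i hi => by interval_cases i <;> simp_all)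
  refine hG F hF ⟨⟨3, by norm_num, hℓ, hB⟩, ?_⟩
  rintro ⟨K, hK⟩
  have h0F : e ∈ F := (hmem e).2 ⟨0, by norm_num, by simp⟩
  have h1F : e₁ ∈ F := (hmem e₁).2 ⟨1, by norm_num, by simp⟩
  have h2F : e₂ ∈ F := (hmem e₂).2 ⟨2, by norm_num, by simp⟩
  have hbK : b ∈ K := hK e h0F e₁ h1F hne ▸ Finset.mem_inter.2 ⟨hb, hb₁⟩
  rw [← hK e₁ h1F e₂ h2F h12] at hbK
  exact hb₂ (Finset.mem_inter.1 hbK).2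

open Finset in
/-- Every edge has a pair of vertices contained in no other edge. -/
theorem IsFree.exists_own_pair {V : Type*} [DecidableEq V] {ℓ r : ℕ} {G : Finset (Finset V)}
    (hG : IsFree (IsShortNonSunflowerBergeCycle r ℓ) G) (hu : IsUniform r G) (hℓ : 3 ≤ ℓ)
    (hr : 2 ≤ r) {e : Finset V} (he : e ∈ G) :
    ∃ p ⊆ e, p.card = 2 ∧ ∀ e' ∈ G, p ⊆ e' → e' = e := by
  by_cases hlin : ∀ e' ∈ G, e' ≠ e → (e ∩ e').card ≤ 1
  · obtain ⟨p, hp, hpc⟩ := exists_subset_card_eq (hr.trans (hu e he).ge)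
    refine ⟨p, hp, hpc, fun e' he' hpe' => by_contra fun hne => ?_⟩
    have h1 := hlin e' he' hne
    have h2 := card_le_card (subset_inter hp hpe')
    omega
  push Not at hlin
  obtain ⟨e', he', hne', hc'⟩ := hlin
  -- Take e₁ with largest intersection with e, then a in e ∩ e₁ and x in e \ e₁. By the triangle
  -- lemma, another edge through a and x would contain e ∩ e₁ together with x, against maximality.
  obtain ⟨e₁, he₁, hmax⟩ := exists_max_image (G.erase e) (fun f => (e ∩ f).card)
    ⟨e', mem_erase.2 ⟨hne', he'⟩⟩
  obtain ⟨hne₁, he₁⟩ := mem_erase.1 he₁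
  have hc₁ := hc'.trans_le (hmax e' (mem_erase.2 ⟨hne', he'⟩))
  obtain ⟨x, hx, hx₁⟩ : ∃ x ∈ e, x ∉ e₁ := by
    by_contra! hsub
    exact hne₁ (eq_of_subset_of_card_le hsub (by rw [hu e he, hu e₁ he₁])).symm
  obtain ⟨a, ha⟩ := card_pos.1 (zero_lt_one.trans hc₁)
  obtain ⟨hae, ha₁⟩ := mem_inter.1 ha
  have hax : a ≠ x := fun h => hx₁ (h ▸ ha₁)
  refine ⟨{a, x}, ?_, card_pair hax, fun e₂ he₂ hp => by_contra fun hne₂ => ?_⟩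
  · simp [insert_subset_iff, hae, hx]
  have ha₂ : a ∈ e₂ := hp (by simp)
  have hx₂ : x ∈ e₂ := hp (by simp)
  have hsub : e ∩ e₁ ⊂ e ∩ e₂ := by
    refine Finset.ssubset_iff_of_subset (fun b hb => ?_) |>.2
      ⟨x, mem_inter.2 ⟨hx, hx₂⟩, fun h => hx₁ (mem_inter.1 h).2⟩
    obtain ⟨hbe, hb₁⟩ := mem_inter.1 hb
    refine mem_inter.2 ⟨hbe, ?_⟩
    by_cases hab : a = b
    · exact hab ▸ ha₂
    · exact hG.not_triangle hu hℓ he he₁ he₂ hne₁.symm hab hax (fun h => hx₁ (h ▸ hb₁))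
        ha₁ ha₂ hbe hb₁ hx hx₂
  exact absurd (card_lt_card hsub) (not_lt.2 (hmax e₂ (mem_erase.2 ⟨hne₂, he₂⟩)))

open Finset in
/-- Passing to a graph of large girth with the same number of edges. -/
theorem IsFree.exists_graph {V : Type*} [DecidableEq V] {ℓ r : ℕ} {G : Finset (Finset V)}
    (hG : IsFree (IsShortNonSunflowerBergeCycle r ℓ) G) (hu : IsUniform r G) (hℓ : 3 ≤ ℓ)
    (hr : 2 ≤ r) :
    ∃ P : Finset (Finset V), IsUniform 2 P ∧ (∀ d, 2 ≤ d → d ≤ ℓ → ¬ HasBerge P d) ∧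
      P.card = G.card := by
  have hex : ∀ e, ∃ p : Finset V, e ∈ G → p ⊆ e ∧ p.card = 2 ∧ ∀ e' ∈ G, p ⊆ e' → e' = e := by
    intro e
    by_cases he : e ∈ G
    · obtain ⟨p, hp⟩ := hG.exists_own_pair hu hℓ hr he
      exact ⟨p, fun _ => hp⟩
    · exact ⟨∅, fun h => absurd h he⟩
  choose p hp using hex
  refine ⟨G.image p, ?_, ?_, ?_⟩
  · intro h hh
    obtain ⟨g, hg, rfl⟩ := mem_image.1 hh
    exact (hp g hg).2.1
  · rintro d hd hdl ⟨v, f, hv, hf, hc, h⟩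
    have hg : ∀ i, ∃ g, i < d → g ∈ G ∧ p g = f i := by
      intro i
      by_cases hi : i < d
      · obtain ⟨g, hg, hge⟩ := mem_image.1 (h i hi).1
        exact ⟨g, fun _ => ⟨hg, hge⟩⟩
      · exact ⟨∅, fun h => absurd h hi⟩
    choose g hg using hg
    have hginj : Set.InjOn g (Set.Iio d) := fun i hi j hj hij => hf hi hj (by
      rw [← (hg i hi).2, ← (hg j hj).2, hij])
    have hgm : ∀ i < d, g i ∈ G ∧ v i ∈ g i ∧ v (i + 1) ∈ g i := by
      intro i hi
      obtain ⟨h1, h2⟩ := hg i hi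
      obtain ⟨-, h3, h4⟩ := h i hi
      rw [← h2] at h3 h4
      exact ⟨h1, (hp _ h1).1 h3, (hp _ h1).1 h4⟩
    have hne01 : g 0 ≠ g 1 := fun h01 => by
      have := hginj (show 0 ∈ Set.Iio d by simp; omega) (show 1 ∈ Set.Iio d by simp; omega) h01
      omega
    have hlast : v 0 ∈ g (d - 1) := by
      have := (hgm (d - 1) (by omega)).2.2
      rwa [show d - 1 + 1 = d by omega, hc] at this
    -- The lifted Berge cycle is a sunflower, so v 0, which lies in its first and last edges, is in
    -- the kernel. Then g 1 contains both v 0 and v 1, the pair owned by g 0.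
    have hv01 : v 0 ∈ g 1 := by
      by_cases hd2 : d = 2
      · simpa [hd2] using hlast
      obtain ⟨F, hF, hB, hmem⟩ := exists_subset_isBergeCycle hu hd v g hv hginj hc hgm
      have hsun : IsSunflower F := by
        by_contra hns
        exact hG F hF ⟨⟨d, hd, hdl, hB⟩, hns⟩
      obtain ⟨K, hK⟩ := hsun
      have hne : g 0 ≠ g (d - 1) := fun h0 => by
        have := hginj (show 0 ∈ Set.Iio d by simp; omega)
          (show d - 1 ∈ Set.Iio d by simp; omega) h0
        omega
      have hF0 := (hmem (g 0)).2 ⟨0, by omega, rfl⟩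
      have h1 : v 0 ∈ K := hK _ hF0 _ ((hmem _).2 ⟨d - 1, by omega, rfl⟩) hne ▸
        mem_inter.2 ⟨(hgm 0 (by omega)).2.1, hlast⟩
      rw [← hK _ hF0 _ ((hmem _).2 ⟨1, by omega, rfl⟩) hne01] at h1
      exact (mem_inter.1 h1).2
    have hpair : p (g 0) = {v 0, v 1} := by
      have hne : v 0 ≠ v 1 := fun h01 => by
        have := hv (show 0 ∈ Set.Iio d by simp; omega) (show 1 ∈ Set.Iio d by simp; omega) h01
        omega
      refine (eq_of_subset_of_card_le ?_ ?_).symm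
      · rw [(hg 0 (by omega)).2, insert_subset_iff, singleton_subset_iff]
        exact (h 0 (by omega)).2
      · rw [card_pair hne, (hp _ (hg 0 (by omega)).1).2.1]
    refine hne01 ((hp _ (hg 0 (by omega)).1).2.2 (g 1) (hg 1 (by omega)).1 ?_).symm
    rw [hpair, insert_subset_iff, singleton_subset_iff]
    exact ⟨hv01, (hgm 1 (by omega)).2.1⟩
  · refine card_image_of_injOn fun g hg g' hg' hgg => ?_
    exact ((hp g hg).2.2 g' hg' (by rw [hgg]; exact (hp g' hg').1)).symm

/-! ### The Moore bound -/

-- Deleting a vertex of degree at most m with its edges preserves the inequality, since the support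
-- shrinks by at least one.
open Finset in
theorem exists_subset_lt_degree {V : Type*} [DecidableEq V] (m n : ℕ) :
    ∀ P : Finset (Finset V), P.card = n → m * (P.biUnion id).card < P.card →
      ∃ P' ⊆ P, P'.Nonempty ∧ ∀ g ∈ P', ∀ v ∈ g, m < degree P' v := by
  induction n using Nat.strong_induction_on with
  | _ n ih =>
  intro P hP hm
  by_cases hall : ∀ g ∈ P, ∀ v ∈ g, m < degree P v
  · exact ⟨P, Subset.rfl, card_pos.1 (by omega), hall⟩
  push Not at hall
  obtain ⟨g, hg, v, hv, hdeg⟩ := hall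
  have hsplit : degree P v + (P.filter fun g => v ∉ g).card = P.card :=
    card_filter_add_card_filter_not (s := P) (fun g => v ∈ g)
  have hpos : 0 < degree P v := card_pos.2 ⟨g, mem_filter.2 ⟨hg, hv⟩⟩
  have hvs : v ∈ P.biUnion id := mem_biUnion.2 ⟨g, hg, hv⟩
  have hsupp : ((P.filter fun g => v ∉ g).biUnion id).card + 1 ≤ (P.biUnion id).card := by
    have h1 : (P.filter fun g => v ∉ g).biUnion id ⊆ (P.biUnion id).erase v := by
      intro w hw
      obtain ⟨f, hf, hwf⟩ := mem_biUnion.1 hw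
      obtain ⟨hf, hvf⟩ := mem_filter.1 hf
      exact mem_erase.2 ⟨fun h => hvf (h ▸ hwf), mem_biUnion.2 ⟨f, hf, hwf⟩⟩
    have h2 := card_le_card h1
    have h3 := card_erase_add_one hvs
    omega
  obtain ⟨P', hP', h⟩ := ih (P.filter fun g => v ∉ g).card (by omega) _ rfl (by
    have := Nat.mul_le_mul_left m hsupp
    rw [mul_add, mul_one] at this
    omega)
  exact ⟨P', hP'.trans (filter_subset _ _), h⟩

/-- Strip common last steps. If the walks still differ just before a common endpoint, one followed
by the reverse of the other is a nonbacktracking closed walk of length at most 2k, which yields a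
short cycle. Turning back at the base point does no harm. -/
theorem eq_of_nonbacktracking {V : Type*} [DecidableEq V] {P : Finset (Finset V)} {k : ℕ}
    (hP : ∀ d, 2 ≤ d → d ≤ 2 * k → ¬ HasBerge P d) {x y : ℕ → V}
    (hx : ∀ i, {x i, x (i + 1)} ∈ P ∧ x i ≠ x (i + 1) ∧ x i ≠ x (i + 2))
    (hy : ∀ i, {y i, y (i + 1)} ∈ P ∧ y i ≠ y (i + 1) ∧ y i ≠ y (i + 2)) (h0 : x 0 = y 0)
    (n : ℕ) : n ≤ k → x n = y n → ∀ i ≤ n, x i = y i := by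
  induction n with
  | zero => intro _ _ i hi; rwa [Nat.le_zero.1 hi]
  | succ n ih =>
    intro hnk hn i hi
    rcases Nat.le_succ_iff.1 hi with hi | rfl
    swap
    · exact hn
    refine ih (by omega) ?_ i hi
    by_contra hne
    let z : ℕ → V := fun i => if i ≤ n + 1 then x i else y (2 * (n + 1) - i)
    have hz1 : ∀ i ≤ n + 1, z i = x i := fun i hi => if_pos hi
    have hz2 : ∀ i, n + 1 ≤ i → z i = y (2 * (n + 1) - i) := fun i hi => by
      rcases eq_or_lt_of_le hi with rfl | hi
      · rw [hz1 _ le_rfl, hn]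
        congr 1
        omega
      · exact if_neg (by omega)
    have hstep : ∀ i < 2 * (n + 1), {z i, z (i + 1)} ∈ P ∧ z i ≠ z (i + 1) := by
      intro i hi
      rcases Nat.lt_or_ge i (n + 1) with h | h
      · rw [hz1 i h.le, hz1 (i + 1) h]
        exact ⟨(hx i).1, (hx i).2.1⟩
      · rw [hz2 i h, hz2 (i + 1) (by omega),
          show 2 * (n + 1) - i = 2 * (n + 1) - (i + 1) + 1 by omega]
        have := hy (2 * (n + 1) - (i + 1))
        rw [Finset.pair_comm]
        exact ⟨this.1, this.2.1.symm⟩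
    have hback : ∀ i, i + 1 < 2 * (n + 1) → z i ≠ z (i + 2) := by
      intro i hi
      rcases Nat.lt_trichotomy i n with h | h | h
      · rw [hz1 i (by omega), hz1 (i + 2) (by omega)]
        exact (hx i).2.2
      · rw [hz1 i (by omega), hz2 (i + 2) (by omega), h,
          show 2 * (n + 1) - (n + 2) = n by omega]
        exact hne
      · rw [hz2 i h, hz2 (i + 2) (by omega),
          show 2 * (n + 1) - i = 2 * (n + 1) - (i + 2) + 2 by omega]
        exact (hy _).2.2.symm
    obtain ⟨d, hd2, hd, hB⟩ := exists_hasBerge_of_nonbacktracking (k := 2 * (n + 1)) (by omega) z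
      (fun i => {z i, z (i + 1)}) (fun i hi => ⟨(hstep i hi).1, by simp, by simp⟩)
      (fun i hi => (hstep i hi).2)
      (fun i hi heq => by
        have h1 : z i ∈ ({z (i + 1), z (i + 1 + 1)} : Finset V) := by
          have : z i ∈ ({z i, z (i + 1)} : Finset V) := by simp
          rwa [heq] at this
        rw [Finset.mem_insert, Finset.mem_singleton] at h1
        rcases h1 with h1 | h1
        · exact (hstep i (by omega)).2 h1
        · exact hback i hi h1)
      (by rw [hz1 0 (by omega), hz2 _ (by omega), Nat.sub_self, h0])
    exact hP d hd2 (hd.trans (by omega)) hB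

open Finset in
/-- The Moore bound for graphs without cycles of length at most `2 * k`. -/
theorem pow_le_card_of_not_hasBerge {V : Type*} [Fintype V] [DecidableEq V]
    {P : Finset (Finset V)} (hu : IsUniform 2 P) {k m : ℕ} (hk : 0 < k)
    (hP : ∀ d, 2 ≤ d → d ≤ 2 * k → ¬ HasBerge P d) (hm : m * Fintype.card V < P.card) :
    m ^ k ≤ Fintype.card V := by
  obtain ⟨Q, hQ, ⟨g₀, hg₀⟩, hdeg⟩ := exists_subset_lt_degree m _ P rfl
    ((Nat.mul_le_mul_left m (card_le_univ _)).trans_lt hm)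
  -- Here u is the previous vertex and v the current one; degree above m leaves at least m
  -- continuations other than u.
  have hnb : ∀ u v : V, ∃ φ : Fin m → V, (∃ g ∈ Q, v ∈ g) →
      Function.Injective φ ∧ ∀ i, {v, φ i} ∈ Q ∧ v ≠ φ i ∧ u ≠ φ i := by
    intro u v
    by_cases hv : ∃ g ∈ Q, v ∈ g
    swap
    · exact ⟨fun _ => v, fun h => absurd h hv⟩
    obtain ⟨g, hg, hvg⟩ := hv
    set N : Finset V := univ.filter fun w => {v, w} ∈ Q ∧ v ≠ w ∧ u ≠ w with hN
    have hcov : (Q.filter fun g => v ∈ g) ⊆ insert {v, u} (N.image fun w => {v, w}) := by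
      intro f hf
      obtain ⟨hfQ, hvf⟩ := mem_filter.1 hf
      obtain ⟨w, hvw, rfl⟩ : ∃ w, v ≠ w ∧ f = {v, w} := by
        obtain ⟨a, b, hab, rfl⟩ := card_eq_two.1 (hu f (hQ hfQ))
        rw [mem_insert, mem_singleton] at hvf
        rcases hvf with rfl | rfl
        · exact ⟨b, hab, rfl⟩
        · exact ⟨a, hab.symm, pair_comm _ _⟩
      by_cases huw : u = w
      · rw [huw]
        exact mem_insert_self _ _
      · exact mem_insert_of_mem (mem_image_of_mem _
          (mem_filter.2 ⟨mem_univ _, hfQ, hvw, huw⟩))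
    have h1 : m < N.card + 1 := (hdeg g hg v hvg).trans_le ((card_le_card hcov).trans
      ((card_insert_le _ _).trans (Nat.add_le_add_right card_image_le 1)))
    refine ⟨fun i => N.equivFin.symm (Fin.castLE (by omega) i), fun _ => ⟨?_, fun i => ?_⟩⟩
    · intro i j hij
      exact Fin.castLE_injective _ (N.equivFin.symm.injective (Subtype.ext hij))
    · exact (mem_filter.1 (N.equivFin.symm (Fin.castLE (by omega) i)).2).2
  choose nb hnb using hnb
  obtain ⟨v₀, hv₀⟩ := card_pos.1 (show 0 < g₀.card by rw [hu g₀ (hQ hg₀)]; norm_num)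
  -- The state is (previous, current) vertex. Starting at (v₀, v₀) excludes no real neighbour at the
  -- first step.
  let st : (ℕ → Fin m) → ℕ → V × V := fun w j =>
    Nat.rec (v₀, v₀) (fun j p => (p.2, nb p.1 p.2 (w j))) j
  have hst : ∀ w j, st w (j + 1) = ((st w j).2, nb (st w j).1 (st w j).2 (w j)) := fun _ _ => rfl
  have hsupp : ∀ w j, ∃ g ∈ Q, (st w j).2 ∈ g := by
    intro w j
    induction j with
    | zero => exact ⟨g₀, hg₀, hv₀⟩
    | succ j ih =>
      rw [hst]
      exact ⟨_, ((hnb _ _ ih).2 (w j)).1, mem_insert_of_mem (mem_singleton_self _)⟩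
  have hwalk : ∀ w i, {(st w i).2, (st w (i + 1)).2} ∈ P ∧ (st w i).2 ≠ (st w (i + 1)).2 ∧
      (st w i).2 ≠ (st w (i + 2)).2 := by
    intro w i
    have h1 := (hnb (st w i).1 _ (hsupp w i)).2 (w i)
    have h2 := (hnb (st w (i + 1)).1 _ (hsupp w (i + 1))).2 (w (i + 1))
    exact ⟨hQ h1.1, h1.2.1, h2.2.2⟩
  let ext : (Fin k → Fin m) → ℕ → Fin m := fun w j => if h : j < k then w ⟨j, h⟩ else w ⟨0, hk⟩
  -- The endpoint determines the walk, and the walk determines the word letter by letter.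
  have hinj : Function.Injective fun w : Fin k → Fin m => (st (ext w) k).2 := by
    intro w w' hww
    have hall := eq_of_nonbacktracking hP (hwalk (ext w)) (hwalk (ext w')) rfl k le_rfl hww
    have hst_eq : ∀ j ≤ k, st (ext w) j = st (ext w') j := by
      intro j hj
      refine Prod.ext ?_ (hall j hj)
      cases j with
      | zero => rfl
      | succ j => exact hall j (by omega)
    funext j
    have h1 := hall (j + 1) j.2
    rw [hst, hst, hst_eq j j.2.le] at h1
    have h2 := (hnb _ _ (hsupp (ext w') j)).1 h1
    simpa [ext] using h2
  simpa using Fintype.card_le_of_injective _ hinj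

/-! ### Assembling both bounds -/

theorem isFree_empty_isShortNonSunflowerBergeCycle {V : Type*} [DecidableEq V] (r ℓ : ℕ) :
    IsFree (IsShortNonSunflowerBergeCycle (V := V) r ℓ) ∅ :=
  (sunflowerClosed_empty ℓ).isFree r

open Finset in
theorem maxDegree_complete_le (n r : ℕ) : maxDegree (complete (Fin n) r) ≤ n ^ (r - 1) := by
  refine Finset.sup_le fun v _ => ?_
  refine le_trans (card_le_card_of_injOn (t := powersetCard (r - 1) (univ : Finset (Fin n)))
    (fun e => e.erase v) ?_ ?_) ?_
  · intro e he
    obtain ⟨h1, h2⟩ := mem_filter.1 he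
    rw [mem_coe, mem_powersetCard, card_erase_of_mem h2, isUniform_complete _ r e h1]
    exact ⟨subset_univ _, rfl⟩
  · intro e he e' he' hee
    rw [← insert_erase (mem_filter.1 he).2, ← insert_erase (mem_filter.1 he').2]
    exact congrArg _ hee
  · rw [card_powersetCard, card_univ, Fintype.card_fin]
    exact Nat.choose_le_pow n (r - 1)

theorem relEx_complete_le {ℓ r n : ℕ} (hℓ : 3 ≤ ℓ) (hr : 2 ≤ r) (hn : 0 < n) :
    (relEx (complete (Fin n) r) (IsShortNonSunflowerBergeCycle r ℓ) : ℝ) ≤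
      2 * (n : ℝ) ^ (1 + 1 / ((ℓ / 2 : ℕ) : ℝ)) := by
  have hk : 0 < ℓ / 2 := by omega
  set k := ℓ / 2 with hkdef
  obtain ⟨G, hG, hfree, hcard⟩ := exists_isFree_card_eq_relEx (complete (Fin n) r)
    (IsShortNonSunflowerBergeCycle r ℓ) (isFree_empty_isShortNonSunflowerBergeCycle r ℓ)
  obtain ⟨P, hPu, hP, hPc⟩ :=
    hfree.exists_graph (fun e he => isUniform_complete _ r e (hG he)) hℓ hr
  rw [← hcard, ← hPc]
  have hn1 : (1 : ℝ) ≤ n := by exact_mod_cast hn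
  set y : ℝ := (n : ℝ) ^ (1 / (k : ℝ)) with hy
  have hy1 : 1 ≤ y := Real.one_le_rpow hn1 (by positivity)
  -- Chosen so that m^k > n, which makes more than m n edges contradict the Moore bound.
  set m : ℕ := ⌊y⌋₊ + 1 with hm
  have hmk : n < m ^ k := by
    have h1 : y < m := by
      rw [hm]
      push_cast
      exact Nat.lt_floor_add_one y
    have h2 : y ^ k < (m : ℝ) ^ k := pow_lt_pow_left₀ h1 (by linarith) (by omega)
    have h3 : y ^ k = n := by
      rw [hy, ← Real.rpow_natCast, ← Real.rpow_mul (by linarith), one_div,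
        inv_mul_cancel₀ (by positivity), Real.rpow_one]
    rw [h3] at h2
    exact_mod_cast h2
  have hle : P.card ≤ m * n := by
    by_contra hlt
    have := pow_le_card_of_not_hasBerge (m := m) hPu hk
      (fun d hd hdk => hP d hd (by omega)) (by rw [Fintype.card_fin]; omega)
    rw [Fintype.card_fin] at this
    omega
  have hm2 : (m : ℝ) ≤ 2 * y := by
    rw [hm]
    push_cast
    have := Nat.floor_le (show 0 ≤ y by linarith)
    linarith
  calc (P.card : ℝ) ≤ m * n := by exact_mod_cast hle
    _ ≤ 2 * y * n := by gcongr
    _ = _ := by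
      rw [hy, add_comm, Real.rpow_add_one (by positivity)]
      ring

theorem le_card_complete {n r : ℕ} (hnr : 2 * r ≤ n) :
    (n : ℝ) ^ r / (2 ^ r * r.factorial) ≤ (complete (Fin n) r).card := by
  rw [complete, Finset.card_powersetCard, Finset.card_univ, Fintype.card_fin]
  refine le_trans ?_ (Nat.pow_le_choose r n)
  rw [← div_div, ← div_pow]
  gcongr
  have h1 : n ≤ 2 * (n + 1 - r) := by omega
  have h2 : (n : ℝ) ≤ 2 * (n + 1 - r : ℕ) := by exact_mod_cast h1
  linarith

theorem relEx_le_of_maxDegree_le {ℓ r : ℕ} (hℓ : 3 ≤ ℓ) (hr : 3 ≤ r)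
    (hgirth : GirthConjecture ℓ r) {ε : ℝ} (hε : 0 < ε) :
    ∃ Δ₀ : ℕ, ∀ Δ : ℕ, Δ₀ ≤ Δ → ∀ (V : Type*) [Fintype V] [DecidableEq V] (H : Finset (Finset V)),
      IsUniform r H → maxDegree H ≤ Δ →
        (Δ : ℝ) ^ (-1 + 1 / (((r : ℝ) - 1) * ((ℓ / 2 : ℕ) : ℝ)) - ε) * (H.card : ℝ) ≤
          (relEx H (IsShortNonSunflowerBergeCycle r ℓ) : ℝ) := by
  obtain ⟨c, hc, hb⟩ := exists_relativeBound (ℓ := ℓ) (by omega) hgirth r (by omega) le_rfl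
    (ε / 2) (by positivity)
  -- For large Δ the spare factor Δ^(ε/2) absorbs the constant c.
  have hlarge := ((tendsto_rpow_atTop (half_pos hε)).comp
    tendsto_natCast_atTop_atTop).eventually_ge_atTop (1 / c)
  obtain ⟨Δ₀, hΔ₀⟩ := Filter.eventually_atTop.1 hlarge
  refine ⟨max Δ₀ 1, fun Δ hΔ V _ _ H hH hdeg => ?_⟩
  have hΔ1 : 1 ≤ Δ := (le_max_right _ _).trans hΔ
  have hΔr : (0 : ℝ) < Δ := by exact_mod_cast hΔ1
  obtain ⟨G, hG, hGs, hGc⟩ := hb V H Δ hΔ1 hH fun v =>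
    (Finset.le_sup (f := degree H) (Finset.mem_univ v)).trans hdeg
  have h1 : 1 / c ≤ (Δ : ℝ) ^ (ε / 2) := hΔ₀ Δ ((le_max_left _ _).trans hΔ)
  have h2 : 1 ≤ c * (Δ : ℝ) ^ (ε / 2) := by
    rwa [div_le_iff₀ hc, mul_comm] at h1
  have h3 : (G.card : ℝ) ≤ relEx H (IsShortNonSunflowerBergeCycle r ℓ) :=
    Nat.cast_le.2 ((hGs.isFree r).card_le_relEx hG)
  refine le_trans ?_ (hGc.trans h3)
  set b : ℝ := -1 + 1 / (((r : ℝ) - 1) * ((ℓ / 2 : ℕ) : ℝ)) with hbdef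
  have h4 : (Δ : ℝ) ^ (b - ε / 2) = (Δ : ℝ) ^ (b - ε) * (Δ : ℝ) ^ (ε / 2) := by
    rw [← Real.rpow_add hΔr]
    congr 1
    ring
  rw [h4]
  refine mul_le_mul_of_nonneg_right ?_ (Nat.cast_nonneg _)
  calc (Δ : ℝ) ^ (b - ε) = (Δ : ℝ) ^ (b - ε) * 1 := (mul_one _).symm
    _ ≤ (Δ : ℝ) ^ (b - ε) * (c * (Δ : ℝ) ^ (ε / 2)) := by gcongr
    _ = _ := by ring

theorem relEx_complete_le_of_eq_floor {ℓ r : ℕ} (hℓ : 3 ≤ ℓ) (hr : 3 ≤ r) {ε : ℝ} (hε : 0 < ε) :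
    ∃ Δ₀ : ℕ, ∀ Δ n : ℕ, Δ₀ ≤ Δ → n = ⌊(Δ : ℝ) ^ (1 / ((r : ℝ) - 1))⌋₊ →
      maxDegree (complete (Fin n) r) ≤ Δ ∧ 0 < (complete (Fin n) r).card ∧
        (relEx (complete (Fin n) r) (IsShortNonSunflowerBergeCycle r ℓ) : ℝ) ≤
          (Δ : ℝ) ^ (-1 + 1 / (((r : ℝ) - 1) * ((ℓ / 2 : ℕ) : ℝ)) + ε) *
            ((complete (Fin n) r).card : ℝ) := by
  have hr3 : (3 : ℝ) ≤ r := by exact_mod_cast hr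
  have hr1 : (0 : ℝ) < (r : ℝ) - 1 := by linarith
  have hk1 : (1 : ℝ) ≤ ((ℓ / 2 : ℕ) : ℝ) := by
    exact_mod_cast (Nat.le_div_iff_mul_le (by norm_num)).2 (by omega)
  set k : ℝ := ((ℓ / 2 : ℕ) : ℝ) with hk
  set a : ℝ := 1 + 1 / k - r with ha
  have ha0 : a ≤ 0 := by
    have : 1 / k ≤ 1 := by
      rw [div_le_one (by linarith)]
      exact hk1
    linarith
  -- The factors come from the Moore bound, from the lower bound for the binomial coefficient, and
  -- from n ≥ τ / 2 raised to the nonpositive power a.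
  set C : ℝ := 2 * (2 ^ r * r.factorial) * (1 / 2) ^ a with hC
  have hlarge := ((tendsto_rpow_atTop hε).comp
    tendsto_natCast_atTop_atTop).eventually_ge_atTop C
  have hlarge' := ((tendsto_rpow_atTop (one_div_pos.2 hr1)).comp
    tendsto_natCast_atTop_atTop).eventually_ge_atTop (2 * r : ℝ)
  obtain ⟨Δ₀, hΔ₀⟩ := Filter.eventually_atTop.1 (hlarge.and hlarge')
  refine ⟨max Δ₀ 1, fun Δ n hΔ hn => ?_⟩
  obtain ⟨hΔC, hΔτ⟩ := hΔ₀ Δ ((le_max_left _ _).trans hΔ)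
  simp only [Function.comp_apply] at hΔC hΔτ
  have hΔr : (0 : ℝ) < Δ := by exact_mod_cast (le_max_right _ _).trans hΔ
  set τ : ℝ := (Δ : ℝ) ^ (1 / ((r : ℝ) - 1)) with hτ
  have hτ0 : 0 < τ := by positivity
  have hn2r : 2 * r ≤ n := by
    rw [hn]
    exact Nat.le_floor (by push_cast; exact hΔτ)
  have hnτ : (n : ℝ) ≤ τ := hn ▸ Nat.floor_le hτ0.le
  have hn0 : 0 < n := by omega
  have hnr : (0 : ℝ) < n := by exact_mod_cast hn0
  have hτn : 1 / 2 * τ ≤ n := by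
    have h1 : τ < n + 1 := hn ▸ Nat.lt_floor_add_one τ
    have h2 : (1 : ℝ) ≤ n := by exact_mod_cast hn0
    linarith
  have hcard := le_card_complete hn2r
  refine ⟨?_, ?_, ?_⟩
  · have h1 : τ ^ (r - 1) = Δ := by
      rw [hτ, ← Real.rpow_natCast, ← Real.rpow_mul hΔr.le, Nat.cast_sub (by omega), Nat.cast_one,
        one_div, inv_mul_cancel₀ hr1.ne', Real.rpow_one]
    have h2 : (n : ℝ) ^ (r - 1) ≤ Δ := h1 ▸ pow_le_pow_left₀ hnr.le hnτ _
    exact (maxDegree_complete_le n r).trans (by exact_mod_cast h2)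
  · have : (0 : ℝ) < (complete (Fin n) r).card := lt_of_lt_of_le (by positivity) hcard
    exact_mod_cast this
  · refine (relEx_complete_le hℓ (by omega) hn0).trans ?_
    have h1 : (n : ℝ) ^ a ≤ (1 / 2 * τ) ^ a :=
      Real.rpow_le_rpow_of_nonpos (by positivity) hτn ha0
    have h2 : (1 / 2 * τ) ^ a = (1 / 2) ^ a * (Δ : ℝ) ^ (-1 + 1 / (((r : ℝ) - 1) * k)) := by
      rw [Real.mul_rpow (by norm_num) hτ0.le, hτ, ← Real.rpow_mul hΔr.le]
      congr 2
      rw [ha]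
      field_simp
      ring
    rw [h2] at h1
    have h3 : (n : ℝ) ^ (1 + 1 / k) = (n : ℝ) ^ a * n ^ r := by
      rw [← Real.rpow_natCast, ← Real.rpow_add hnr]
      congr 1
      rw [ha]
      ring
    rw [Real.rpow_add hΔr]
    set x : ℝ := (Δ : ℝ) ^ (-1 + 1 / (((r : ℝ) - 1) * k)) with hx
    have hx0 : 0 < x := by positivity
    calc 2 * (n : ℝ) ^ (1 + 1 / k) ≤ 2 * ((1 / 2) ^ a * x * n ^ r) := by
          rw [h3]
          gcongr
      _ = x * C * ((n : ℝ) ^ r / (2 ^ r * r.factorial)) := by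
          rw [hC]
          field_simp
      _ ≤ x * (Δ : ℝ) ^ ε * (complete (Fin n) r).card := by gcongr

end Hypergraph

theorem theorem1 (ℓ r : ℕ) (hℓ : 3 ≤ ℓ) (hr : 3 ≤ r) (hgirth : Hypergraph.GirthConjecture ℓ r) :
    -- the lower bound for all hosts; the threshold depends on `ℓ, r, ε` only
    (∀ ε : ℝ, 0 < ε → ∃ Δ₀ : ℕ, ∀ Δ : ℕ, Δ₀ ≤ Δ →
      ∀ (V : Type*) [Fintype V] [DecidableEq V] (H : Finset (Finset V)),
        Hypergraph.IsUniform r H → Hypergraph.maxDegree H ≤ Δ →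
          (Δ : ℝ) ^ (-1 + 1 / (((r : ℝ) - 1) * ((ℓ / 2 : ℕ) : ℝ)) - ε) * (H.card : ℝ) ≤
            (Hypergraph.relEx H (Hypergraph.IsShortNonSunflowerBergeCycle r ℓ) : ℝ)) ∧
    -- tightness for the clique with `⌊Δ ^ (1 / (r - 1))⌋` vertices
    (∀ ε : ℝ, 0 < ε → ∃ Δ₀ : ℕ, ∀ Δ n : ℕ, Δ₀ ≤ Δ → n = ⌊(Δ : ℝ) ^ (1 / ((r : ℝ) - 1))⌋₊ →
      Hypergraph.maxDegree (Hypergraph.complete (Fin n) r) ≤ Δ ∧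
        0 < (Hypergraph.complete (Fin n) r).card ∧
        (Hypergraph.relEx (Hypergraph.complete (Fin n) r)
            (Hypergraph.IsShortNonSunflowerBergeCycle r ℓ) : ℝ) ≤
          (Δ : ℝ) ^ (-1 + 1 / (((r : ℝ) - 1) * ((ℓ / 2 : ℕ) : ℝ)) + ε) *
            ((Hypergraph.complete (Fin n) r).card : ℝ)) := ⟨fun _ hε => Hypergraph.relEx_le_of_maxDegree_le hℓ hr hgirth hε,
    fun _ hε => Hypergraph.relEx_complete_le_of_eq_floor hℓ hr hε⟩
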